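/- Consider bipartite (Tanner) graphs with finitely many symbol nodes and check nodes, in which a set $\mathcal P$ of symbols is punctured (not transmitted). Let $\mathcal N(u)$ be the set of neighbours of a node $u$, and $\mathcal N^n(u)$ the set of nodes reachable from $u$ by traversing at most $n$ edges. A symbol $v\in\mathcal P$ is in $\mathcal R_1$ if some $c\in\mathcal N(v)$ has no punctured neighbour other than $v$. For $n\ge 2$, a symbol $v\in\mathcal P$ with $v\notin\mathcal R_1\cup\dots\cup\mathcal R_{n-1}$ is in $\mathcal R_n$ if there are $c\in\mathcal N(v)$ and $w\in\mathcal N(c)\setminus\{v\}$ with $w\in\mathcal R_{n-1}$ such that every punctured $w'\in\mathcal N(c)\setminus\{v,w\}$ is in $\mathcal R_1\cup\dots\cup\mathcal R_{n-1}$. For $v\in\mathcal R_k$ assume that the graph on $\mathcal N^{2k}(v)$ is a tree, and root it at $v$. The extended recovery tree $\mathcal T_v$ is the connected component of $v$ after removing from this tree every edge between a symbol $w$ and a child check $c$ of $w$ such that $w\in\mathcal R_m$ and some child of $c$ is in $\mathcal R_j$ with $j>m-1$. The recovery error probability $P_e(v)$ is the probability that $v$ is decoded as one after $k$ iterations of sum-product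 decoding on $\mathcal T_v$, given that the all-zero codeword is sent. Here every non-punctured symbol is sent independently through the channel, punctured symbols start from the probabilities $(\tfrac12,\tfrac12)$, and a tie is decided by a fair coin. Theorem. Let $0\le l<k$ be integers, and let $v_1,v_2$ be punctured symbols (of the same or of two different punctured Tanner graphs), both in $\mathcal R_k$, with $\mathcal N^{2k}(v_1)$ and $\mathcal N^{2k}(v_2)$ tree-like. Let $x\in\mathcal N^{2l}(v_2)$ be a symbol of $\mathcal T_{v_2}$, and let $z$ be a check that is a child of $x$ in $\mathcal T_{v_2}$ and satisfies $\max\{m : \mathcal N(z)\cap\mathcal R_m\neq\emptyset\}=k-l$ (the neighbourhood $\mathcal N(z)$ includes $x$). Suppose that $\mathcal T_{v_1}$ and $\mathcal T_{v_2}$ are identical except for the link of $x$ with $z$: deleting $z$ and all its descendants from $\mathcal T_{v_2}$ leaves a tree isomorphic to $\mathcal T_{v_1}$, by an isomorphism that maps $v_2$ to $v_1$ and respects the types of the nodes (check, punctured symbol, non-punctured symbol). Then, over every binary-input memoryless channel with symmetric output (some measurable involution of the output alphabet exchanges the output distributions of the inputs $0$ and $1$), the same for both trees, $$P_e(v_1)\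 \ge\ P_e(v_2).$$ -/

import Mathlib

open scoped ENNReal

/-- A Tanner graph: a bipartite graph linking symbol nodes `S` with check nodes `C`. -/
structure TannerGraph (S C : Type*) where
  edge : S → C → Prop

namespace TannerGraph

variable {S C : Type*}

/-- The underlying simple graph on the disjoint union of symbol and check nodes. -/
def graph (G : TannerGraph S C) : SimpleGraph (S ⊕ C) where
  Adj a b :=
    (∃ s c, a = Sum.inl s ∧ b = Sum.inr c ∧ G.edge s c) ∨
      (∃ s c, a = Sum.inr c ∧ b = Sum.inl s ∧ G.edge s c)
  symm := ⟨by
    rintro a b (⟨s, c, rfl, rfl, h⟩ | ⟨s, c, rfl, rfl, h⟩)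
    · exact Or.inr ⟨s, c, rfl, rfl, h⟩
    · exact Or.inl ⟨s, c, rfl, rfl, h⟩⟩
  loopless := ⟨by
    rintro a (⟨s, c, h, h', -⟩ | ⟨s, c, h, h', -⟩) <;> simp [h] at h'⟩

/-- `N^n(u)`: the nodes reachable from `u` by traversing at most `n` edges. -/
def nbhd (G : TannerGraph S C) (n : ℕ) (u : S ⊕ C) : Set (S ⊕ C) :=
  {w | ∃ p : G.graph.Walk u w, p.length ≤ n}

/-- `R_k`, the set of `k`-step extended recoverable symbols for the set `P` of punctured
symbols (`R_0` is empty). -/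
def recoverable (G : TannerGraph S C) (P : Set S) : ℕ → Set S
  | 0 => ∅
  | 1 => {v | v ∈ P ∧ ∃ c, G.edge v c ∧ ∀ w, G.edge w c → w ≠ v → w ∉ P}
  | (n + 2) =>
    {v | v ∈ P ∧ (∀ m : Fin (n + 2), v ∉ recoverable G P m.1) ∧
      ∃ c, G.edge v c ∧ ∃ w, G.edge w c ∧ w ≠ v ∧ w ∈ recoverable G P (n + 1) ∧
        ∀ w', G.edge w' c → w' ≠ v → w' ≠ w → w' ∈ P →
          ∃ m : Fin (n + 2), w' ∈ recoverable G P m.1}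
termination_by n => n
decreasing_by
  all_goals first | exact m.2 | exact Nat.lt_succ_self _

/-- The graph subjacent to `N^{2k}(v)` is a tree. -/
def TreeLike (G : TannerGraph S C) (v : S) (k : ℕ) : Prop :=
  (G.graph.induce (G.nbhd (2 * k) (Sum.inl v))).IsTree

/-- `w ∈ N_↓(u)`: in the graph on `N^{2k}(v)`, rooted at `v`, the node `w` is a child of `u`. -/
def Child (G : TannerGraph S C) (v : S) (k : ℕ) (u w : S ⊕ C) : Prop :=
  w ∈ G.nbhd (2 * k) (Sum.inl v) ∧ G.graph.Adj u w ∧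
    G.graph.dist (Sum.inl v) w = G.graph.dist (Sum.inl v) u + 1

/-- `u` together with all its descendants in the graph on `N^{2k}(v)`, rooted at `v`. -/
def descendants (G : TannerGraph S C) (v : S) (k : ℕ) (u : S ⊕ C) : Set (S ⊕ C) :=
  {w | Relation.ReflTransGen (G.Child v k) u w}

/-- The connection of the symbol `s` with the check `c` is eliminated when the recovery tree is
formed: `c ∈ N_↓(s)`, `s ∈ R_m`, and the maximum of the `j` such that some `w ∈ N_↓(c)` lies in
`R_j` exceeds `m - 1`. -/
def Eliminated (G : TannerGraph S C) (P : Set S) (v : S) (k : ℕ) (s : S) (c : C) : Prop :=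
  G.Child v k (Sum.inl s) (Sum.inr c) ∧
    ∃ m, s ∈ G.recoverable P m ∧
      ∃ w, G.Child v k (Sum.inr c) (Sum.inl w) ∧ ∃ j, w ∈ G.recoverable P j ∧ m ≤ j

/-- The graph on `N^{2k}(v)` without the eliminated connections. -/
def pruned (G : TannerGraph S C) (P : Set S) (v : S) (k : ℕ) : TannerGraph S C where
  edge s c :=
    Sum.inl s ∈ G.nbhd (2 * k) (Sum.inl v) ∧ Sum.inr c ∈ G.nbhd (2 * k) (Sum.inl v) ∧
      G.edge s c ∧ ¬ G.Eliminated P v k s c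

/-- The nodes of the extended recovery tree of `v`: those which stay connected with `v`. -/
def treeNodes (G : TannerGraph S C) (P : Set S) (v : S) (k : ℕ) : Set (S ⊕ C) :=
  {u | (G.pruned P v k).graph.Reachable (Sum.inl v) u}

/-- The extended recovery tree of `v ∈ R_k`, as a Tanner graph whose edges are those of the
tree (its nodes are `treeNodes`; any other node is isolated). -/
def recoveryTree (G : TannerGraph S C) (P : Set S) (v : S) (k : ℕ) : TannerGraph S C where
  edge s c := (G.pruned P v k).edge s c ∧ Sum.inl s ∈ G.treeNodes P v k

end TannerGraph

/-- The three kinds of nodes of a punctured Tanner graph. -/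
inductive NodeKind
  | check
  | punctured
  | transmitted

open scoped Classical in
/-- The kind of a node, for the set `P` of punctured symbols. -/
noncomputable def nodeKind {S C : Type*} (P : Set S) : S ⊕ C → NodeKind
  | Sum.inl s => if s ∈ P then NodeKind.punctured else NodeKind.transmitted
  | Sum.inr _ => NodeKind.check

/-- The extended recovery trees of `v₁` and `v₂` are identical, except that in the tree of `v₂`
the symbol `x` is linked with one more child check `z`, from which a further subtree hangs:
removing `z` and its descendants from the tree of `v₂` leaves the tree of `v₁`, up to a graph
isomorphism which respects the root and the kinds of the nodes. -/
def IdenticalExcept {S₁ C₁ S₂ C₂ : Type*} (G₁ : TannerGraph S₁ C₁) (P₁ : Set S₁) (v₁ : S₁)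
    (G₂ : TannerGraph S₂ C₂) (P₂ : Set S₂) (v₂ : S₂) (k : ℕ) (x : S₂) (z : C₂) : Prop :=
  (G₂.recoveryTree P₂ v₂ k).edge x z ∧ G₂.Child v₂ k (Sum.inl x) (Sum.inr z) ∧
    ∃ φ : (G₁.recoveryTree P₁ v₁ k).graph.induce (G₁.treeNodes P₁ v₁ k) ≃g
        (G₂.recoveryTree P₂ v₂ k).graph.induce
          (G₂.treeNodes P₂ v₂ k \ G₂.descendants v₂ k (Sum.inr z)),
      (∀ u, u.1 = Sum.inl v₁ → (φ u).1 = Sum.inl v₂) ∧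
        ∀ u, nodeKind P₂ (φ u).1 = nodeKind P₁ u.1

/-- A binary-input memoryless channel with symmetric output: `law b` is the distribution of the
output when `b` is sent, and an involution of the output alphabet (such as `y ↦ -y`) exchanges
the two distributions. -/
structure SymmetricChannel (Y : Type*) [MeasurableSpace Y] where
  law : ZMod 2 → MeasureTheory.Measure Y
  prob : ∀ b, MeasureTheory.IsProbabilityMeasure (law b)
  symmetric : ∃ f : Y → Y, Measurable f ∧ Function.Involutive f ∧
    (law 0).map f = law 1 ∧ (law 1).map f = law 0

/-- The probability, given the output `y`, that the input, drawn uniformly, was `b`: the density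
of `law b` with respect to `law 0 + law 1`. -/
noncomputable def SymmetricChannel.posterior {Y : Type*} [MeasurableSpace Y]
    (W : SymmetricChannel Y) (b : ZMod 2) (y : Y) : ℝ≥0∞ :=
  (W.law b).rnDeriv (W.law 0 + W.law 1) y

open scoped Classical in
/-- The initial message of a symbol: a punctured symbol takes both values with probability one
half, and any other symbol uses its channel output. -/
noncomputable def initialMessage {S Y : Type*} [MeasurableSpace Y] (W : SymmetricChannel Y)
    (P : Set S) (y : S → Y) (s : S) (b : ZMod 2) : ℝ≥0∞ :=
  if s ∈ P then 1 / 2 else W.posterior b (y s)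

namespace TannerGraph

variable {S C : Type*} [Fintype S] [Fintype C]

open scoped Classical in
/-- The message which check `c` sends to symbol `s`, from the messages `msg` that it received: the
sum over all assignments to the other symbols of `c` which, with the value `b` of `s`, satisfy the
parity check. -/
noncomputable def checkMessage (T : TannerGraph S C) (msg : S → C → ZMod 2 → ℝ≥0∞)
    (c : C) (s : S) (b : ZMod 2) : ℝ≥0∞ :=
  ∑ a : {w : S // T.edge w c ∧ w ≠ s} → ZMod 2,
    if b + ∑ w, a w = 0 then ∏ w, msg w.1 c (a w) else 0

open scoped Classical in
/-- Sum-product decoding on `T`: the message, up to normalization, which symbol `s` sends to check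
`c` after `t` iterations; `ini` holds the initial messages. (The log-likelihood ratio of a message
`m` is `log (m 0 / m 1)`.) -/
noncomputable def symbolMessage (T : TannerGraph S C) (ini : S → ZMod 2 → ℝ≥0∞) :
    ℕ → S → C → ZMod 2 → ℝ≥0∞
  | 0, s, _, b => ini s b
  | t + 1, s, c, b =>
    ini s b * ∏ c' : C with T.edge s c' ∧ c' ≠ c,
      T.checkMessage (symbolMessage T ini t) c' s b

open scoped Classical in
/-- The estimate of symbol `s` after `t` iterations of sum-product decoding on `T`, up to
normalization. -/
noncomputable def belief (T : TannerGraph S C) (ini : S → ZMod 2 → ℝ≥0∞) :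
    ℕ → S → ZMod 2 → ℝ≥0∞
  | 0, s, b => ini s b
  | t + 1, s, b =>
    ini s b * ∏ c' : C with T.edge s c', T.checkMessage (T.symbolMessage ini t) c' s b

/-- The extended recovery error probability `P_e(v)` of `v ∈ R_k`: the probability that `v` is
decoded as one after `k` iterations of sum-product decoding on the extended recovery tree of `v`,
when the all-zero codeword is sent; ties are decided by a fair coin. (The channel outputs that are
formally attached to punctured symbols are never used.) -/
noncomputable def errorProb {Y : Type*} [MeasurableSpace Y] (W : SymmetricChannel Y)
    (G : TannerGraph S C) (P : Set S) (k : ℕ) (v : S) : ℝ≥0∞ :=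
  let est : (S → Y) → ZMod 2 → ℝ≥0∞ := fun y =>
    (G.recoveryTree P v k).belief (initialMessage W P y) k v
  let μ : MeasureTheory.Measure (S → Y) := MeasureTheory.Measure.pi fun _ => W.law 0
  μ {y | est y 0 < est y 1} + μ {y | est y 0 = est y 1} / 2

end TannerGraph

/-! A message m about a bit is recorded by its soft bit D = (m 0 - m 1) / (m 0 + m 1) in [-1, 1]. A
check multiplies the soft bits that it receives; a symbol merges two soft bits into (x + y) / (1 + x
* y). On a tree the messages that meet at a node depend on disjoint sets of channel outputs, hence
are independent, and decoding becomes a recursion on laws through `mulLaw` and `combineLaw`. Channel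
symmetry makes all these laws a `SymmetricLaw`, and for such a law the error probability is (1 -
E|D|) / 2 (`error_eq_ofReal_integral`).

Laws are compared by the means of max(|a * D|, |b|) for all a and b (`Degraded`). The case b = 0
alone does not support an induction, since combining with y turns |x| into max(|x|, |y|). The whole
family is closed: a product rescales a (`test_mul`), and combining with y gives, after
symmetrization, the mean of two test functions of x whose parameters depend on y
(`test_combine_average`). Hence both operations are monotone. The point mass at 0 is the least
symmetric law and is neutral for `combineLaw`, so an additional independent message never harms
(`degraded_combineLaw`).

The tree of v₁ embeds into that of v₂ so that matched checks have the same children, while a symbol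
may gain checks (`exists_partialEmbedding`). Induction on the iterations (`degraded_upwardLaw`)
carries the order up to the roots, where a = 1, b = 0 compares the error probabilities. -/

namespace SoftBit

open MeasureTheory ProbabilityTheory

/-! ### Symmetric laws of soft bits and symmetrized integrals. -/

/-- The law, given that the bit is zero, of the difference of the two normalized values of a
message in a symmetric setting: the laws for the two values of the bit are exchanged by negation
and have the likelihood ratio `(1 + x) / (1 - x)`. -/
structure SymmetricLaw (ρ : Measure ℝ) : Prop where
  prob : IsProbabilityMeasure ρ
  abs_le : ∀ᵐ x ∂ρ, |x| ≤ 1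
  symm : ∀ f : ℝ → ℝ, Measurable f → (∃ K, ∀ x, |x| ≤ 1 → |f x| ≤ K) →
    ∫ x, f x ∂ρ = ∫ x, ((1 + x) * f x + (1 - x) * f (-x)) / 2 ∂ρ

/-- The soft bit of the combination of two independent messages about the same bit. -/
noncomputable def combine (x y : ℝ) : ℝ := (x + y) / (1 + x * y)

lemma measurable_combine : Measurable fun p : ℝ × ℝ => combine p.1 p.2 := by
  unfold combine; fun_prop

lemma abs_mul_le_one {x y : ℝ} (hx : |x| ≤ 1) (hy : |y| ≤ 1) : |x * y| ≤ 1 := by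
  rw [abs_mul]; exact mul_le_one₀ hx (abs_nonneg _) hy

/-- Here (1 - x)(1 - y) = -(x + y) and (1 + x)(1 + y) = x + y, and both products are nonnegative.
This is the case of two certain, contradictory messages. -/
lemma add_eq_zero_of_one_add_mul {x y : ℝ} (hx : |x| ≤ 1) (hy : |y| ≤ 1) (h : 1 + x * y = 0) :
    x + y = 0 := by
  rw [abs_le] at hx hy
  nlinarith [sq_nonneg (x + y), mul_nonneg (sub_nonneg.2 hx.2) (sub_nonneg.2 hy.2),
    mul_nonneg (neg_le_iff_add_nonneg.1 hx.1) (neg_le_iff_add_nonneg.1 hy.1)]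

lemma one_add_mul_nonneg {x y : ℝ} (hx : |x| ≤ 1) (hy : |y| ≤ 1) : 0 ≤ 1 + x * y := by
  have := abs_le.1 (abs_mul_le_one hx hy); linarith

/-- The multiplied form needs no case distinction: where the denominator vanishes, so does the
numerator. -/
lemma mul_combine {x y : ℝ} (hx : |x| ≤ 1) (hy : |y| ≤ 1) :
    (1 + x * y) * combine x y = x + y := by
  by_cases h : 1 + x * y = 0
  · rw [h, zero_mul, add_eq_zero_of_one_add_mul hx hy h]
  · unfold combine; field_simp

lemma abs_combine_le {x y : ℝ} (hx : |x| ≤ 1) (hy : |y| ≤ 1) : |combine x y| ≤ 1 := by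
  have h0 := one_add_mul_nonneg hx hy
  unfold combine
  rw [abs_div, abs_of_nonneg h0]
  apply div_le_one_of_le₀ _ h0
  rw [abs_le] at *
  constructor <;> nlinarith

lemma combine_comm (x y : ℝ) : combine x y = combine y x := by
  unfold combine; rw [add_comm, mul_comm x y]

lemma combine_neg_neg (x y : ℝ) : combine (-x) (-y) = -combine x y := by
  unfold combine; rw [neg_mul_neg, ← neg_add, neg_div]

/-- Moves the sign to the left, so that averages over the four sign patterns involve only `combine x
y`, `combine (-x) y` and their negatives. -/
lemma combine_neg_right (x y : ℝ) : combine x (-y) = -combine (-x) y := by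
  rw [← combine_neg_neg, neg_neg]

lemma SymmetricLaw.integrable {ρ : Measure ℝ} (hρ : SymmetricLaw ρ) {f : ℝ → ℝ}
    (hf : Measurable f) {K : ℝ} (hK : ∀ x, |x| ≤ 1 → |f x| ≤ K) : Integrable f ρ := by
  have := hρ.prob
  refine Integrable.of_bound hf.aestronglyMeasurable K ?_
  filter_upwards [hρ.abs_le] with x hx using hK x hx

lemma ae_prod_abs_le {ρ σ : Measure ℝ} (hρ : SymmetricLaw ρ) (hσ : SymmetricLaw σ) :
    ∀ᵐ p ∂ρ.prod σ, |p.1| ≤ 1 ∧ |p.2| ≤ 1 := by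
  have := hρ.prob
  have := hσ.prob
  have h1 := Measure.quasiMeasurePreserving_fst (μ := ρ) (ν := σ) |>.ae hρ.abs_le
  have h2 := Measure.quasiMeasurePreserving_snd (μ := ρ) (ν := σ) |>.ae hσ.abs_le
  filter_upwards [h1, h2] with p a b using ⟨a, b⟩

lemma integrable_prod {ρ σ : Measure ℝ} (hρ : SymmetricLaw ρ) (hσ : SymmetricLaw σ)
    {F : ℝ × ℝ → ℝ} (hF : Measurable F) {K : ℝ}
    (hK : ∀ x y, |x| ≤ 1 → |y| ≤ 1 → |F (x, y)| ≤ K) : Integrable F (ρ.prod σ) := by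
  have := hρ.prob
  have := hσ.prob
  refine Integrable.of_bound hF.aestronglyMeasurable K ?_
  filter_upwards [ae_prod_abs_le hρ hσ] with p hp using hK p.1 p.2 hp.1 hp.2

lemma abs_average_le {y a b K : ℝ} (hy : |y| ≤ 1) (ha : |a| ≤ K) (hb : |b| ≤ K) :
    |((1 + y) * a + (1 - y) * b) / 2| ≤ K := by
  rw [abs_le] at *
  have h1 : 0 ≤ 1 + y := by linarith
  have h2 : 0 ≤ 1 - y := by linarith
  constructor
  · nlinarith [mul_le_mul_of_nonneg_left ha.1 h1, mul_le_mul_of_nonneg_left hb.1 h2]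
  · nlinarith [mul_le_mul_of_nonneg_left ha.2 h1, mul_le_mul_of_nonneg_left hb.2 h2]

lemma integral_prod_symm_right {ρ σ : Measure ℝ} (hρ : SymmetricLaw ρ) (hσ : SymmetricLaw σ)
    {F : ℝ × ℝ → ℝ} (hF : Measurable F) {K : ℝ}
    (hK : ∀ x y, |x| ≤ 1 → |y| ≤ 1 → |F (x, y)| ≤ K) :
    ∫ p, F p ∂ρ.prod σ =
      ∫ p, ((1 + p.2) * F p + (1 - p.2) * F (p.1, -p.2)) / 2 ∂ρ.prod σ := by
  have := hρ.prob
  have := hσ.prob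
  have hm : Measurable fun p : ℝ × ℝ => ((1 + p.2) * F p + (1 - p.2) * F (p.1, -p.2)) / 2 := by
    fun_prop
  rw [MeasureTheory.integral_prod _ (integrable_prod hρ hσ hF hK),
    MeasureTheory.integral_prod _ (integrable_prod hρ hσ hm (K := K) ?_)]
  · refine integral_congr_ae ?_
    filter_upwards [hρ.abs_le] with x hx
    exact hσ.symm (fun y => F (x, y)) (by fun_prop) ⟨K, fun y hy => hK x y hx hy⟩
  · intro x y hx hy
    exact abs_average_le hy (hK x y hx hy) (hK x (-y) hx (by rwa [abs_neg]))

lemma integral_prod_symm_left {ρ σ : Measure ℝ} (hρ : SymmetricLaw ρ) (hσ : SymmetricLaw σ)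
    {F : ℝ × ℝ → ℝ} (hF : Measurable F) {K : ℝ}
    (hK : ∀ x y, |x| ≤ 1 → |y| ≤ 1 → |F (x, y)| ≤ K) :
    ∫ p, F p ∂ρ.prod σ =
      ∫ p, ((1 + p.1) * F p + (1 - p.1) * F (-p.1, p.2)) / 2 ∂ρ.prod σ := by
  have := hρ.prob
  have := hσ.prob
  have h := integral_prod_symm_right hσ hρ (F := F ∘ Prod.swap) (by fun_prop)
    (fun x y hx hy => hK y x hy hx)
  rw [← integral_prod_swap, ← integral_prod_swap (μ := ρ)]
  exact h

/-- Symmetrizing each coordinate in turn reduces identities between integrals over a product of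
symmetric laws to pointwise identities. -/
lemma integral_prod_symm_both {ρ σ : Measure ℝ} (hρ : SymmetricLaw ρ) (hσ : SymmetricLaw σ)
    {F : ℝ × ℝ → ℝ} (hF : Measurable F) {K : ℝ}
    (hK : ∀ x y, |x| ≤ 1 → |y| ≤ 1 → |F (x, y)| ≤ K) :
    ∫ p, F p ∂ρ.prod σ =
      ∫ p, ((1 + p.1) * (1 + p.2) * F p + (1 + p.1) * (1 - p.2) * F (p.1, -p.2) +
        (1 - p.1) * (1 + p.2) * F (-p.1, p.2) +
        (1 - p.1) * (1 - p.2) * F (-p.1, -p.2)) / 4 ∂ρ.prod σ := by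
  rw [integral_prod_symm_right hρ hσ hF hK, integral_prod_symm_left hρ hσ (K := K)]
  · congr 1; ext p; ring
  · fun_prop
  · intro x y hx hy
    exact abs_average_le hy (hK x y hx hy) (hK x (-y) hx (by rwa [abs_neg]))

/-! ### The two operations on laws preserve symmetry. -/

/-- The law of the soft bit of the parity of two independent bits. -/
noncomputable def mulLaw (ρ σ : Measure ℝ) : Measure ℝ := (ρ.prod σ).map fun p => p.1 * p.2

/-- The law of the combination of two independent soft bits. -/
noncomputable def combineLaw (ρ σ : Measure ℝ) : Measure ℝ :=
  (ρ.prod σ).map fun p => combine p.1 p.2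

lemma integral_mulLaw {ρ σ : Measure ℝ} {f : ℝ → ℝ} (hf : Measurable f) :
    ∫ x, f x ∂mulLaw ρ σ = ∫ p, f (p.1 * p.2) ∂ρ.prod σ :=
  integral_map (by fun_prop) hf.aestronglyMeasurable

lemma integral_combineLaw {ρ σ : Measure ℝ} {f : ℝ → ℝ} (hf : Measurable f) :
    ∫ x, f x ∂combineLaw ρ σ = ∫ p, f (combine p.1 p.2) ∂ρ.prod σ :=
  integral_map measurable_combine.aemeasurable hf.aestronglyMeasurable

/-- Equal signs carry the total weight (1 + x)(1 + y) + (1 - x)(1 - y) = 2(1 + xy), opposite signs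
2(1 - xy): the weights required of the product. -/
lemma SymmetricLaw.mulLaw {ρ σ : Measure ℝ} (hρ : SymmetricLaw ρ) (hσ : SymmetricLaw σ) :
    SymmetricLaw (mulLaw ρ σ) := by
  have := hρ.prob
  have := hσ.prob
  refine ⟨Measure.isProbabilityMeasure_map (by fun_prop), ?_, ?_⟩
  · refine (ae_map_iff (by fun_prop) (measurableSet_le (by fun_prop) (by fun_prop))).2 ?_
    filter_upwards [ae_prod_abs_le hρ hσ] with p hp using abs_mul_le_one hp.1 hp.2
  · rintro f hf ⟨K, hK⟩
    rw [integral_mulLaw hf, integral_mulLaw (by fun_prop),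
      integral_prod_symm_both hρ hσ (K := K) (by fun_prop)
        (fun x y hx hy => hK _ (abs_mul_le_one hx hy))]
    congr 1; ext p
    simp only [neg_mul, mul_neg, neg_neg]
    ring

/-- Both sides are averaged over signs. With u = `combine x y`, the relation (1 + xy)u = x + y gives
(1 + xy)(1 + u) = (1 + x)(1 + y), which matches the weights; the opposite signs are the same with -x
for x. -/
lemma SymmetricLaw.combineLaw {ρ σ : Measure ℝ} (hρ : SymmetricLaw ρ) (hσ : SymmetricLaw σ) :
    SymmetricLaw (combineLaw ρ σ) := by
  have := hρ.prob
  have := hσ.prob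
  have hmc := measurable_combine
  refine ⟨Measure.isProbabilityMeasure_map hmc.aemeasurable, ?_, ?_⟩
  · refine (ae_map_iff hmc.aemeasurable (measurableSet_le (by fun_prop) (by fun_prop))).2 ?_
    filter_upwards [ae_prod_abs_le hρ hσ] with p hp using abs_combine_le hp.1 hp.2
  · rintro f hf ⟨K, hK⟩
    have e := integral_prod_symm_both hρ hσ (F := fun p => f (combine p.1 p.2)) (K := K)
      (by fun_prop) (fun x y hx hy => hK _ (abs_combine_le hx hy))
    have e' := integral_prod_symm_both hρ hσ
      (F := fun p => ((1 + combine p.1 p.2) * f (combine p.1 p.2) +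
        (1 - combine p.1 p.2) * f (-combine p.1 p.2)) / 2) (K := K) (by fun_prop)
      (fun x y hx hy => abs_average_le (abs_combine_le hx hy) (hK _ (abs_combine_le hx hy))
        (hK _ (by rw [abs_neg]; exact abs_combine_le hx hy)))
    rw [integral_combineLaw hf, integral_combineLaw (by fun_prop), e, e']
    refine integral_congr_ae ?_
    filter_upwards [ae_prod_abs_le hρ hσ] with p hp
    have e1 := mul_combine hp.1 hp.2
    have e2 := mul_combine (x := -p.1) (y := p.2) (by rw [abs_neg]; exact hp.1) hp.2
    simp only [combine_neg_right, neg_neg]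
    generalize combine p.1 p.2 = u at *
    generalize combine (-p.1) p.2 = w at *
    linear_combination (f (-u) - f u) / 4 * e1 + (f (-w) - f w) / 4 * e2

/-- The law of a bit known with certainty, sent by a check without other symbols. -/
lemma symmetricLaw_dirac_one : SymmetricLaw (Measure.dirac 1) where
  prob := inferInstance
  abs_le := by simp
  symm f hf _ := by
    rw [integral_dirac, integral_dirac]; ring

/-- The law of an uninformative message: that of a punctured symbol, and of an empty product of
messages. -/
lemma symmetricLaw_dirac_zero : SymmetricLaw (Measure.dirac 0) where
  prob := inferInstance
  abs_le := by simp
  symm f hf _ := by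
    rw [integral_dirac, integral_dirac, neg_zero]; ring

/-! ### The degradation order and the monotonicity of both operations. -/

/-- A convex even test function; up to a factor two, the larger one of `|a * x|` and `|b|`. -/
def test (a b x : ℝ) : ℝ := |a * x + b| + |a * x - b|

lemma measurable_test (a b : ℝ) : Measurable (test a b) := by
  unfold test; fun_prop

lemma abs_test_le (a b : ℝ) {x : ℝ} (hx : |x| ≤ 1) : |test a b x| ≤ 2 * (|a| + |b|) := by
  have h1 := abs_add_le (a * x) b
  have h2 := abs_sub (a * x) b
  have h3 : |a * x| ≤ |a| := by
    rw [abs_mul]; exact mul_le_of_le_one_right (abs_nonneg _) hx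
  rw [test, abs_of_nonneg (by positivity)]
  linarith

lemma test_neg (a b x : ℝ) : test a b (-x) = test a b x := by
  unfold test
  rw [← abs_neg (a * -x + b), ← abs_neg (a * -x - b), add_comm]
  congr 2 <;> ring

/-- The law `ρ'` is at most as informative as the law `ρ`. -/
def Degraded (ρ' ρ : Measure ℝ) : Prop :=
  ∀ a b, ∫ x, test a b x ∂ρ' ≤ ∫ x, test a b x ∂ρ

lemma Degraded.refl (ρ : Measure ℝ) : Degraded ρ ρ := fun _ _ => le_rfl

lemma Degraded.trans {ρ σ τ : Measure ℝ} (h : Degraded ρ σ) (h' : Degraded σ τ) :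
    Degraded ρ τ := fun a b => (h a b).trans (h' a b)

lemma mulLaw_comm (ρ σ : Measure ℝ) [SFinite ρ] [SFinite σ] : mulLaw ρ σ = mulLaw σ ρ := by
  rw [mulLaw, mulLaw, ← Measure.prod_swap, Measure.map_map (by fun_prop) (by fun_prop)]
  congr 1; ext p; exact mul_comm _ _

lemma combineLaw_comm (ρ σ : Measure ℝ) [SFinite ρ] [SFinite σ] :
    combineLaw ρ σ = combineLaw σ ρ := by
  rw [combineLaw, combineLaw, ← Measure.prod_swap,
    Measure.map_map measurable_combine (by fun_prop)]
  congr 1; ext p; exact combine_comm _ _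

/-- Closure of the test functions under products: for fixed y only the parameter a changes. -/
lemma test_mul (a b x y : ℝ) : test a b (x * y) = test (a * y) b x := by
  unfold test; ring_nf

lemma Degraded.mulLaw_right {ρ' ρ σ : Measure ℝ} (hρ' : SymmetricLaw ρ') (hρ : SymmetricLaw ρ)
    (hσ : SymmetricLaw σ) (h : Degraded ρ' ρ) : Degraded (mulLaw ρ' σ) (mulLaw ρ σ) := by
  intro a b
  have := hρ.prob
  have := hρ'.prob
  have := hσ.prob
  have hb : ∀ x y : ℝ, |x| ≤ 1 → |y| ≤ 1 → |test a b (x * y)| ≤ 2 * (|a| + |b|) :=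
    fun x y hx hy => abs_test_le a b (abs_mul_le_one hx hy)
  have hm : Measurable fun p : ℝ × ℝ => test a b (p.1 * p.2) :=
    (measurable_test a b).comp (by fun_prop)
  have i' := integrable_prod hρ' hσ hm hb
  have i := integrable_prod hρ hσ hm hb
  rw [integral_mulLaw (measurable_test a b), integral_mulLaw (measurable_test a b),
    MeasureTheory.integral_prod_symm _ i', MeasureTheory.integral_prod_symm _ i]
  refine integral_mono i'.integral_prod_right i.integral_prod_right fun y => ?_
  simp only [test_mul]
  exact h _ _

lemma mul_test {t : ℝ} (ht : 0 ≤ t) (a b u : ℝ) :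
    t * test a b u = |a * (t * u) + b * t| + |a * (t * u) - b * t| := by
  unfold test
  rw [mul_add]
  nth_rw 1 2 [← abs_of_nonneg ht]
  rw [← abs_mul, ← abs_mul]
  congr 2 <;> ring

/-- The factors 1 ± xy clear the denominators. Since a(x + y) + b(1 + xy) = (a + by)x + (ay + b),
and changing x to -x flips only the first summand, the four absolute values regroup into two test
functions of x. -/
lemma test_combine_average (a b : ℝ) {x y : ℝ} (hx : |x| ≤ 1) (hy : |y| ≤ 1) :
    (1 + x * y) * test a b (combine x y) + (1 - x * y) * test a b (combine (-x) y) =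
      test (a + b * y) (a * y + b) x + test (a - b * y) (a * y - b) x := by
  have hx' : |-x| ≤ 1 := by rwa [abs_neg]
  have e2 := one_add_mul_nonneg hx' hy
  have e3 := mul_combine hx' hy
  have e : 1 - x * y = 1 + -x * y := by ring
  rw [e, mul_test (one_add_mul_nonneg hx hy), mul_test e2, e3, mul_combine hx hy]
  unfold test
  rw [← abs_neg (a * (-x + y) + b * (1 + -x * y)), ← abs_neg (a * (-x + y) - b * (1 + -x * y))]
  ring_nf

lemma integral_test_combineLaw {ρ σ : Measure ℝ} (hρ : SymmetricLaw ρ) (hσ : SymmetricLaw σ)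
    (a b : ℝ) :
    ∫ x, test a b x ∂combineLaw ρ σ =
      ∫ p, (test (a + b * p.2) (a * p.2 + b) p.1 +
        test (a - b * p.2) (a * p.2 - b) p.1) / 2 ∂ρ.prod σ := by
  have hm := (measurable_test a b).comp measurable_combine
  rw [integral_combineLaw (measurable_test a b),
    integral_prod_symm_both hρ hσ (F := fun p => test a b (combine p.1 p.2)) hm
      (fun x y hx hy => abs_test_le a b (abs_combine_le hx hy))]
  refine integral_congr_ae ?_
  filter_upwards [ae_prod_abs_le hρ hσ] with p hp
  have h := test_combine_average a b hp.1 hp.2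
  simp only [combine_neg_right, neg_neg, test_neg]
  linear_combination h / 2

/-- For fixed y the hypothesis is used at the parameters (a + by, ay + b) and (a - by, ay - b); the
result is then integrated over y. -/
lemma Degraded.combineLaw_right {ρ' ρ σ : Measure ℝ} (hρ' : SymmetricLaw ρ')
    (hρ : SymmetricLaw ρ) (hσ : SymmetricLaw σ) (h : Degraded ρ' ρ) :
    Degraded (combineLaw ρ' σ) (combineLaw ρ σ) := by
  intro a b
  have := hρ.prob
  have := hρ'.prob
  have := hσ.prob
  have hm : Measurable fun p : ℝ × ℝ => (test (a + b * p.2) (a * p.2 + b) p.1 +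
        test (a - b * p.2) (a * p.2 - b) p.1) / 2 := by
    unfold test; fun_prop
  have hb : ∀ x y : ℝ, |x| ≤ 1 → |y| ≤ 1 → |(test (a + b * y) (a * y + b) x +
      test (a - b * y) (a * y - b) x) / 2| ≤ 2 * (|a| + |b|) := by
    intro x y hx hy
    -- Read backwards, the identity shows a weighted mean of values of `test a b` on [-1, 1], which
    -- gives a bound free of y.
    rw [← test_combine_average a b hx hy]
    exact abs_average_le (abs_mul_le_one hx hy) (abs_test_le a b (abs_combine_le hx hy))
      (abs_test_le a b (abs_combine_le (by rwa [abs_neg]) hy))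
  have i' := integrable_prod hρ' hσ hm hb
  have i := integrable_prod hρ hσ hm hb
  rw [integral_test_combineLaw hρ' hσ, integral_test_combineLaw hρ hσ,
    MeasureTheory.integral_prod_symm _ i', MeasureTheory.integral_prod_symm _ i]
  refine integral_mono i'.integral_prod_right i.integral_prod_right fun y => ?_
  have j : ∀ {τ : Measure ℝ}, SymmetricLaw τ → ∀ c d, Integrable (test c d) τ :=
    fun hτ c d => hτ.integrable (measurable_test c d) (fun x hx => abs_test_le c d hx)
  simp only [integral_div]
  rw [integral_add (j hρ' _ _) (j hρ' _ _), integral_add (j hρ _ _) (j hρ _ _)]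
  have h1 := h (a + b * y) (a * y + b)
  have h2 := h (a - b * y) (a * y - b)
  linarith

lemma Degraded.mulLaw {ρ' ρ σ' σ : Measure ℝ} (hρ' : SymmetricLaw ρ') (hρ : SymmetricLaw ρ)
    (hσ' : SymmetricLaw σ') (hσ : SymmetricLaw σ) (h : Degraded ρ' ρ) (k : Degraded σ' σ) :
    Degraded (mulLaw ρ' σ') (mulLaw ρ σ) := by
  have := hρ.prob
  have := hσ'.prob
  have := hσ.prob
  refine (h.mulLaw_right hρ' hρ hσ').trans ?_
  rw [mulLaw_comm ρ, mulLaw_comm ρ]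
  exact k.mulLaw_right hσ' hσ hρ

lemma Degraded.combineLaw {ρ' ρ σ' σ : Measure ℝ} (hρ' : SymmetricLaw ρ')
    (hρ : SymmetricLaw ρ) (hσ' : SymmetricLaw σ') (hσ : SymmetricLaw σ) (h : Degraded ρ' ρ)
    (k : Degraded σ' σ) : Degraded (combineLaw ρ' σ') (combineLaw ρ σ) := by
  have := hρ.prob
  have := hσ'.prob
  have := hσ.prob
  refine (h.combineLaw_right hρ' hρ hσ').trans ?_
  rw [combineLaw_comm ρ, combineLaw_comm ρ]
  exact k.combineLaw_right hσ' hσ hρ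

/-- By the triangle inequality every test function attains its minimum 2|b| at 0. -/
lemma degraded_dirac_zero {ρ : Measure ℝ} (hρ : SymmetricLaw ρ) :
    Degraded (Measure.dirac 0) ρ := by
  intro a b
  have := hρ.prob
  rw [integral_dirac]
  have : ∫ x, test a b 0 ∂ρ = test a b 0 := by simp
  rw [← this]
  refine integral_mono (integrable_const _)
    (hρ.integrable (measurable_test a b) fun x hx => abs_test_le a b hx) fun x => ?_
  unfold test
  have := abs_sub (a * x + b) (a * x - b)
  rw [show a * x + b - (a * x - b) = 2 * b by ring, abs_mul, abs_two] at this
  simp only [mul_zero, zero_add, zero_sub, abs_neg]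
  linarith

/-! ### Soft bits of products and of parity messages. -/

/-- The difference of the two values of a message, after normalization. -/
noncomputable def softBit (m : ZMod 2 → ℝ≥0∞) : ℝ :=
  ((m 0).toReal - (m 1).toReal) / ((m 0).toReal + (m 1).toReal)

lemma measurable_softBit : Measurable softBit := by
  unfold softBit; fun_prop

/-- A finite message which does not exclude the value zero. -/
structure Proper (m : ZMod 2 → ℝ≥0∞) : Prop where
  pos : m 0 ≠ 0
  fin : ∀ b, m b ≠ ∞

lemma Proper.toReal_pos {m : ZMod 2 → ℝ≥0∞} (h : Proper m) : 0 < (m 0).toReal :=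
  ENNReal.toReal_pos h.pos (h.fin 0)

lemma Proper.mul {m n : ZMod 2 → ℝ≥0∞} (hm : Proper m) (hn : Proper n) : Proper (m * n) :=
  ⟨mul_ne_zero hm.pos hn.pos, fun b => ENNReal.mul_ne_top (hm.fin b) (hn.fin b)⟩

lemma proper_one : Proper 1 := ⟨one_ne_zero, fun _ => ENNReal.one_ne_top⟩

lemma Proper.prod {ι : Type*} {A : Finset ι} {m : ι → ZMod 2 → ℝ≥0∞}
    (h : ∀ i ∈ A, Proper (m i)) : Proper (∏ i ∈ A, m i) :=
  Finset.prod_induction _ _ (fun _ _ => Proper.mul) proper_one h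

lemma softBit_one : softBit 1 = 0 := by simp [softBit]

/-- The addition formula of tanh: the soft bit is tanh of half the log-likelihood ratio, and ratios
add. Properness keeps all denominators positive, also when a message excludes the value one. -/
lemma Proper.softBit_mul {m n : ZMod 2 → ℝ≥0∞} (hm : Proper m) (hn : Proper n) :
    softBit (m * n) = combine (softBit m) (softBit n) := by
  have a := hm.toReal_pos
  have b := hn.toReal_pos
  have a' : 0 ≤ (m 1).toReal := ENNReal.toReal_nonneg
  have b' : 0 ≤ (n 1).toReal := ENNReal.toReal_nonneg
  have ab : 0 < (m 0).toReal * (n 0).toReal + (m 1).toReal * (n 1).toReal := by positivity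
  simp only [softBit, combine, Pi.mul_apply, ENNReal.toReal_mul]
  generalize (m 0).toReal = p at *
  generalize (m 1).toReal = q at *
  generalize (n 0).toReal = r at *
  generalize (n 1).toReal = s at *
  have e : 1 + (p - q) / (p + q) * ((r - s) / (r + s)) =
      2 * (p * r + q * s) / ((p + q) * (r + s)) := by
    field_simp; ring
  have e' : (p - q) / (p + q) + (r - s) / (r + s) =
      2 * (p * r - q * s) / ((p + q) * (r + s)) := by
    field_simp; ring
  rw [e, e', div_div_div_cancel_right₀ (by positivity), mul_div_mul_left _ _ two_ne_zero]

section parity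

variable {ι : Type*} [Fintype ι] [DecidableEq ι]

/-- The message about a bit which adds up to zero with the bits of `ι`. -/
noncomputable def parityMessage (m : ι → ZMod 2 → ℝ≥0∞) (b : ZMod 2) : ℝ≥0∞ :=
  ∑ a : ι → ZMod 2, if b + ∑ i, a i = 0 then ∏ i, m i (a i) else 0

lemma measurable_parityMessage :
    Measurable (parityMessage : (ι → ZMod 2 → ℝ≥0∞) → ZMod 2 → ℝ≥0∞) := by
  refine measurable_pi_lambda _ fun b => Finset.measurable_sum _ fun a _ => ?_
  split_ifs
  · exact Finset.measurable_prod _ fun i _ =>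
      (measurable_pi_apply (a i)).comp (measurable_pi_apply i)
  · exact measurable_const

lemma Proper.parityMessage {m : ι → ZMod 2 → ℝ≥0∞} (h : ∀ i, Proper (m i)) :
    Proper (parityMessage m) := by
  refine ⟨fun h0 => ?_, fun b => ENNReal.sum_ne_top.2 fun a _ => ?_⟩
  · have := (Finset.sum_eq_zero_iff.1 h0) 0 (Finset.mem_univ _)
    simp only [Pi.zero_apply, Finset.sum_const_zero, add_zero, if_true] at this
    obtain ⟨i, -, hi⟩ := Finset.prod_eq_zero_iff.1 this
    exact (h i).pos hi
  · split_ifs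
    · exact ENNReal.prod_ne_top fun i _ => (h i).fin _
    · exact ENNReal.zero_ne_top

lemma toReal_parityMessage {m : ι → ZMod 2 → ℝ≥0∞} (h : ∀ i, Proper (m i)) (b : ZMod 2) :
    (parityMessage m b).toReal =
      ∑ a : ι → ZMod 2, if b + ∑ i, a i = 0 then ∏ i, (m i (a i)).toReal else 0 := by
  rw [parityMessage, ENNReal.toReal_sum]
  · refine Finset.sum_congr rfl fun a _ => ?_
    split_ifs
    · exact ENNReal.toReal_prod _ _
    · rfl
  · intro a _
    split_ifs
    · exact ENNReal.prod_ne_top fun i _ => (h i).fin _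
    · exact ENNReal.zero_ne_top

/-- The nontrivial sign character of `ZMod 2`. -/
def sign (b : ZMod 2) : ℝ := if b = 0 then 1 else -1

lemma sign_add (a b : ZMod 2) : sign (a + b) = sign a * sign b := by
  have hz : ∀ s : ZMod 2, s = 0 ∨ s = 1 := by decide
  rcases hz a with rfl | rfl <;> rcases hz b with rfl | rfl <;>
    simp [sign, show (1 : ZMod 2) + 1 = 0 from rfl]

lemma sign_sum (a : ι → ZMod 2) : sign (∑ i, a i) = ∏ i, sign (a i) := by
  have : ∀ A : Finset ι, sign (∑ i ∈ A, a i) = ∏ i ∈ A, sign (a i) := by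
    intro A
    induction A using Finset.induction_on with
    | empty => simp [sign]
    | insert i A hi ih => rw [Finset.sum_insert hi, Finset.prod_insert hi, sign_add, ih]
  exact this _

lemma sum_prod_eq_prod_add (g : ι → ZMod 2 → ℝ) :
    ∑ a : ι → ZMod 2, ∏ i, g i (a i) = ∏ i, (g i 0 + g i 1) := by
  have h : ∀ i, g i 0 + g i 1 = ∑ b : ZMod 2, g i b := fun i => (Fin.sum_univ_two _).symm
  simp_rw [h, Finset.prod_univ_sum, Fintype.piFinset_univ]

/-- Fourier analysis on `ZMod 2`: the sum and the difference of the two values pair the message with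
the trivial character and with `sign`, and each pairing turns the sum over assignments into a
product. -/
lemma softBit_parityMessage {m : ι → ZMod 2 → ℝ≥0∞} (h : ∀ i, Proper (m i)) :
    softBit (parityMessage m) = ∏ i, softBit (m i) := by
  have hz : ∀ s : ZMod 2, s = 0 ∨ s = 1 := by decide
  have hs : (parityMessage m 0).toReal + (parityMessage m 1).toReal =
      ∏ i, ((m i 0).toReal + (m i 1).toReal) := by
    rw [toReal_parityMessage h, toReal_parityMessage h, ← Finset.sum_add_distrib,
      ← sum_prod_eq_prod_add fun i b => (m i b).toReal]
    refine Finset.sum_congr rfl fun a _ => ?_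
    -- Each assignment satisfies the parity condition for exactly one value of the bit, so both
    -- values together count it once.
    rcases hz (∑ i, a i) with e | e <;> rw [e] <;> simp [show (1 : ZMod 2) + 1 = 0 from rfl]
  have hd : (parityMessage m 0).toReal - (parityMessage m 1).toReal =
      ∏ i, ((m i 0).toReal - (m i 1).toReal) := by
    have := sum_prod_eq_prod_add fun i b => sign b * (m i b).toReal
    simp only [Finset.prod_mul_distrib, ← sign_sum] at this
    rw [toReal_parityMessage h, toReal_parityMessage h, ← Finset.sum_sub_distrib]
    have e' : ∀ i, (m i 0).toReal - (m i 1).toReal =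
      sign 0 * (m i 0).toReal + sign 1 * (m i 1).toReal := fun i => by simp [sign]; ring
    simp only [e', ← this]
    refine Finset.sum_congr rfl fun a _ => ?_
    rcases hz (∑ i, a i) with e | e <;> rw [e] <;> simp [sign, show (1 : ZMod 2) + 1 = 0 from rfl]
  rw [softBit, hs, hd, ← Finset.prod_div_distrib]
  rfl

end parity

/-! ### Laws of products of independent messages. -/

section laws

variable {Ω Ω' ι : Type*} [MeasurableSpace Ω] [MeasurableSpace Ω'] {μ : Measure Ω}
  {μ' : Measure Ω'} [IsProbabilityMeasure μ] [IsProbabilityMeasure μ']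

lemma map_mul_eq_mulLaw {X Y : Ω → ℝ} (hX : Measurable X) (hY : Measurable Y)
    (h : IndepFun X Y μ) : μ.map (X * Y) = mulLaw (μ.map X) (μ.map Y) := by
  rw [mulLaw, ← (indepFun_iff_map_prod_eq_prod_map_map hX.aemeasurable hY.aemeasurable).1 h,
    Measure.map_map (by fun_prop) (by fun_prop)]
  rfl

/-- The law of the soft bit of a random message. -/
noncomputable def softLaw (μ : Measure Ω) (Z : Ω → ZMod 2 → ℝ≥0∞) : Measure ℝ :=
  μ.map fun ω => softBit (Z ω)

lemma softLaw_mul {Z Z' : Ω → ZMod 2 → ℝ≥0∞} (hZ : Measurable Z) (hZ' : Measurable Z')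
    (hp : ∀ᵐ ω ∂μ, Proper (Z ω)) (hp' : ∀ᵐ ω ∂μ, Proper (Z' ω)) (h : IndepFun Z Z' μ) :
    softLaw μ (Z * Z') = combineLaw (softLaw μ Z) (softLaw μ Z') := by
  have m := measurable_softBit.comp hZ
  have m' := measurable_softBit.comp hZ'
  have i := h.comp measurable_softBit measurable_softBit
  have e := (indepFun_iff_map_prod_eq_prod_map_map m.aemeasurable m'.aemeasurable).1 i
  simp only [Function.comp_def] at e m m'
  rw [combineLaw, softLaw, softLaw, softLaw, ← e,
    Measure.map_map measurable_combine (by fun_prop)]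
  refine Measure.map_congr ?_
  filter_upwards [hp, hp'] with ω a a' using a.softBit_mul a'

/-- Independence is asked only between one factor and a product of others, which is what an
induction over finite sets consumes. -/
lemma map_prod_mul_insert [DecidableEq ι] {X : ι → Ω → ℝ} (hX : ∀ i, Measurable (X i))
    (hind : ∀ (A : Finset ι) (i : ι), i ∉ A → IndepFun (X i) (∏ j ∈ A, X j) μ)
    {A : Finset ι} {i : ι} (hi : i ∉ A) :
    μ.map (∏ j ∈ insert i A, X j) = mulLaw (μ.map (X i)) (μ.map (∏ j ∈ A, X j)) := by
  rw [Finset.prod_insert hi, map_mul_eq_mulLaw (hX i) ?_ (hind A i hi)]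
  exact Finset.prod_induction _ Measurable (fun _ _ => Measurable.mul) measurable_one
      fun j _ => hX j

lemma symmetricLaw_map_prod {X : ι → Ω → ℝ} (hX : ∀ i, Measurable (X i))
    (hind : ∀ (A : Finset ι) (i : ι), i ∉ A → IndepFun (X i) (∏ j ∈ A, X j) μ)
    (hs : ∀ i, SymmetricLaw (μ.map (X i))) (A : Finset ι) :
    SymmetricLaw (μ.map (∏ i ∈ A, X i)) := by
  classical
  induction A using Finset.induction_on with
  | empty =>
    have : μ.map (∏ i ∈ (∅ : Finset ι), X i) = Measure.dirac 1 := by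
      rw [Finset.prod_empty]
      exact (Measure.map_const μ (1 : ℝ)).trans (by simp)
    rw [this]; exact symmetricLaw_dirac_one
  | insert i A hi ih =>
    rw [map_prod_mul_insert hX hind hi]
    exact (hs i).mulLaw ih

lemma degraded_map_prod {X : ι → Ω → ℝ} {X' : ι → Ω' → ℝ} (hX : ∀ i, Measurable (X i))
    (hX' : ∀ i, Measurable (X' i))
    (hind : ∀ (A : Finset ι) (i : ι), i ∉ A → IndepFun (X i) (∏ j ∈ A, X j) μ)
    (hind' : ∀ (A : Finset ι) (i : ι), i ∉ A → IndepFun (X' i) (∏ j ∈ A, X' j) μ')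
    (hs : ∀ i, SymmetricLaw (μ.map (X i))) (hs' : ∀ i, SymmetricLaw (μ'.map (X' i)))
    (hd : ∀ i, Degraded (μ.map (X i)) (μ'.map (X' i))) (A : Finset ι) :
    Degraded (μ.map (∏ i ∈ A, X i)) (μ'.map (∏ i ∈ A, X' i)) := by
  classical
  induction A using Finset.induction_on with
  | empty =>
    have h : μ.map (∏ i ∈ (∅ : Finset ι), X i) = Measure.dirac 1 := by
      rw [Finset.prod_empty]
      exact (Measure.map_const μ (1 : ℝ)).trans (by simp)
    have h' : μ'.map (∏ i ∈ (∅ : Finset ι), X' i) = Measure.dirac 1 := by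
      rw [Finset.prod_empty]
      exact (Measure.map_const μ' (1 : ℝ)).trans (by simp)
    rw [h, h']; exact Degraded.refl _
  | insert i A hi ih =>
    rw [map_prod_mul_insert hX hind hi, map_prod_mul_insert hX' hind' hi]
    exact (hd i).mulLaw (hs i) (hs' i) (symmetricLaw_map_prod hX hind hs A)
      (symmetricLaw_map_prod hX' hind' hs' A) ih

lemma softLaw_one : softLaw μ (1 : Ω → ZMod 2 → ℝ≥0∞) = Measure.dirac 0 := by
  have : (fun ω => softBit ((1 : Ω → ZMod 2 → ℝ≥0∞) ω)) = fun _ => 0 :=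
    funext fun _ => softBit_one
  rw [softLaw, this, Measure.map_const]; simp

lemma softLaw_prod_insert [DecidableEq ι] {Z : ι → Ω → ZMod 2 → ℝ≥0∞}
    (hZ : ∀ i, Measurable (Z i)) (hp : ∀ i, ∀ᵐ ω ∂μ, Proper (Z i ω))
    (hind : ∀ (A : Finset ι) (i : ι), i ∉ A → IndepFun (Z i) (∏ j ∈ A, Z j) μ)
    {A : Finset ι} {i : ι} (hi : i ∉ A) :
    softLaw μ (∏ j ∈ insert i A, Z j) =
      combineLaw (softLaw μ (Z i)) (softLaw μ (∏ j ∈ A, Z j)) := by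
  rw [Finset.prod_insert hi, softLaw_mul (hZ i) ?_ (hp i) ?_ (hind A i hi)]
  · exact Finset.prod_induction _ Measurable (fun _ _ => Measurable.mul) measurable_one
      fun j _ => hZ j
  · have : ∀ᵐ ω ∂μ, ∀ j ∈ A, Proper (Z j ω) := (Finset.eventually_all A).2 fun j _ => hp j
    filter_upwards [this] with ω h
    rw [Finset.prod_apply]
    exact Proper.prod h

lemma symmetricLaw_softLaw_prod {Z : ι → Ω → ZMod 2 → ℝ≥0∞}
    (hZ : ∀ i, Measurable (Z i)) (hp : ∀ i, ∀ᵐ ω ∂μ, Proper (Z i ω))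
    (hind : ∀ (A : Finset ι) (i : ι), i ∉ A → IndepFun (Z i) (∏ j ∈ A, Z j) μ)
    (hs : ∀ i, SymmetricLaw (softLaw μ (Z i))) (A : Finset ι) :
    SymmetricLaw (softLaw μ (∏ i ∈ A, Z i)) := by
  classical
  induction A using Finset.induction_on with
  | empty => rw [Finset.prod_empty, softLaw_one]; exact symmetricLaw_dirac_zero
  | insert i A hi ih =>
    rw [softLaw_prod_insert hZ hp hind hi]
    exact (hs i).combineLaw ih

lemma degraded_softLaw_prod {Z : ι → Ω → ZMod 2 → ℝ≥0∞} {Z' : ι → Ω' → ZMod 2 → ℝ≥0∞}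
    (hZ : ∀ i, Measurable (Z i)) (hp : ∀ i, ∀ᵐ ω ∂μ, Proper (Z i ω))
    (hind : ∀ (A : Finset ι) (i : ι), i ∉ A → IndepFun (Z i) (∏ j ∈ A, Z j) μ)
    (hs : ∀ i, SymmetricLaw (softLaw μ (Z i)))
    (hZ' : ∀ i, Measurable (Z' i)) (hp' : ∀ i, ∀ᵐ ω ∂μ', Proper (Z' i ω))
    (hind' : ∀ (A : Finset ι) (i : ι), i ∉ A → IndepFun (Z' i) (∏ j ∈ A, Z' j) μ')
    (hs' : ∀ i, SymmetricLaw (softLaw μ' (Z' i)))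
    (hd : ∀ i, Degraded (softLaw μ (Z i)) (softLaw μ' (Z' i))) (A : Finset ι) :
    Degraded (softLaw μ (∏ i ∈ A, Z i)) (softLaw μ' (∏ i ∈ A, Z' i)) := by
  classical
  induction A using Finset.induction_on with
  | empty => rw [Finset.prod_empty, Finset.prod_empty, softLaw_one, softLaw_one]; exact .refl _
  | insert i A hi ih =>
    rw [softLaw_prod_insert hZ hp hind hi, softLaw_prod_insert hZ' hp' hind' hi]
    exact (hd i).combineLaw (hs i) (hs' i) (symmetricLaw_softLaw_prod hZ hp hind hs A)
      (symmetricLaw_softLaw_prod hZ' hp' hind' hs' A) ih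

end laws

/-- The probability of a wrong decision, where a tie is decided by a fair coin, from the law of
the soft bit. -/
lemma error_eq_ofReal_integral {Ω : Type*} [MeasurableSpace Ω] {μ : Measure Ω}
    {Z : Ω → ZMod 2 → ℝ≥0∞} (hZ : Measurable Z)
    (hp : ∀ᵐ ω ∂μ, Proper (Z ω)) (hs : SymmetricLaw (softLaw μ Z)) :
    μ {ω | Z ω 0 < Z ω 1} + μ {ω | Z ω 0 = Z ω 1} / 2 =
      ENNReal.ofReal ((1 - (∫ x, test 1 0 x ∂softLaw μ Z) / 2) / 2) := by
  have hms : Measurable fun ω => softBit (Z ω) := measurable_softBit.comp hZ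
  have := hs.prob
  have h1 : μ {ω | Z ω 0 < Z ω 1} = softLaw μ Z (Set.Iio 0) := by
    rw [softLaw, Measure.map_apply hms measurableSet_Iio]
    refine measure_congr ?_
    filter_upwards [hp] with ω h
    have a := h.toReal_pos
    have b : 0 ≤ (Z ω 1).toReal := ENNReal.toReal_nonneg
    refine propext (show Z ω 0 < Z ω 1 ↔ softBit (Z ω) < 0 from ?_)
    rw [softBit, div_neg_iff, ← ENNReal.toReal_lt_toReal (h.fin 0) (h.fin 1)]
    constructor
    · intro c; right; constructor <;> linarith
    · rintro (c | c) <;> linarith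
  have h2 : μ {ω | Z ω 0 = Z ω 1} = softLaw μ Z {0} := by
    rw [softLaw, Measure.map_apply hms (measurableSet_singleton 0)]
    refine measure_congr ?_
    filter_upwards [hp] with ω h
    have a := h.toReal_pos
    have b : 0 ≤ (Z ω 1).toReal := ENNReal.toReal_nonneg
    refine propext (show Z ω 0 = Z ω 1 ↔ softBit (Z ω) = 0 from ?_)
    rw [softBit, div_eq_zero_iff, ← ENNReal.toReal_eq_toReal_iff' (h.fin 0) (h.fin 1)]
    constructor
    · intro c; left; linarith
    · rintro (c | c) <;> linarith
  have hm : Measurable fun x : ℝ =>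
      (Set.Iio (0 : ℝ)).indicator (1 : ℝ → ℝ) x + ({0} : Set ℝ).indicator (1 : ℝ → ℝ) x / 2 :=
    (measurable_one.indicator measurableSet_Iio).add
      ((measurable_one.indicator (measurableSet_singleton 0)).div_const 2)
  -- The error is the mean of the indicator of x < 0 plus half that of x = 0; its symmetrization is
  -- (1 - |x|) / 2, and `test 1 0 x` is 2|x|.
  have key := hs.symm _ hm ⟨1, fun x _ => by
    rcases lt_trichotomy x 0 with h | h | h
    · simp [h, h.ne]
    · simp [h, abs_of_pos]; norm_num
    · simp [h.le, h.ne']⟩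
  have e : ∀ x : ℝ, ((1 + x) * ((Set.Iio (0 : ℝ)).indicator (1 : ℝ → ℝ) x +
      ({0} : Set ℝ).indicator (1 : ℝ → ℝ) x / 2) + (1 - x) *
      ((Set.Iio (0 : ℝ)).indicator (1 : ℝ → ℝ) (-x) +
      ({0} : Set ℝ).indicator (1 : ℝ → ℝ) (-x) / 2)) / 2 = (1 - test 1 0 x / 2) / 2 := by
    intro x
    rcases lt_trichotomy x 0 with h | h | h
    · simp [test, h, h.ne, h.le, abs_of_neg]
    · simp [test, h]
    · simp [test, h, h.ne', h.le, abs_of_pos]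
  simp only [e] at key
  have it : Integrable (test 1 0) (softLaw μ Z) :=
    hs.integrable (measurable_test 1 0) fun x hx => abs_test_le 1 0 hx
  have i1 : Integrable ((Set.Iio (0 : ℝ)).indicator (1 : ℝ → ℝ)) (softLaw μ Z) :=
    (integrable_const (1 : ℝ)).indicator measurableSet_Iio
  have i2 : Integrable (({0} : Set ℝ).indicator (1 : ℝ → ℝ)) (softLaw μ Z) :=
    (integrable_const (1 : ℝ)).indicator (measurableSet_singleton 0)
  rw [integral_add i1 (i2.div_const 2),
    integral_div, integral_div, integral_sub (integrable_const _) (it.div_const 2), integral_div,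
    integral_indicator_one measurableSet_Iio,
    integral_indicator_one (measurableSet_singleton 0)] at key
  simp only [integral_const, probReal_univ, smul_eq_mul, mul_one] at key
  rw [h1, h2, ← key, ENNReal.ofReal_add (by positivity) (by positivity),
    ENNReal.ofReal_div_of_pos two_pos, Measure.real, Measure.real,
    ENNReal.ofReal_toReal (measure_ne_top _ _), ENNReal.ofReal_toReal (measure_ne_top _ _),
    ENNReal.ofReal_ofNat]

/-- Functions of disjoint sets of coordinates are independent. -/
lemma indepFun_of_dependsOn {S Y β γ : Type*} [Fintype S] [MeasurableSpace Y]
    [MeasurableSpace β] [MeasurableSpace γ] (ν : S → Measure Y) [∀ s, IsProbabilityMeasure (ν s)]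
    {F : (S → Y) → β} {H : (S → Y) → γ} (hF : Measurable F) (hH : Measurable H) {A B : Set S}
    (hA : DependsOn F A) (hB : DependsOn H B) (hAB : Disjoint A B) :
    IndepFun F H (Measure.pi ν) := by
  classical
  rcases isEmpty_or_nonempty S with hS | ⟨⟨s₀⟩⟩
  · have : F = fun _ => F isEmptyElim := funext fun y => congrArg F (Subsingleton.elim _ _)
    rw [this]
    exact indepFun_const_left _ _
  obtain ⟨y₀⟩ : Nonempty Y := (ν s₀).nonempty_of_neZero
  have hi : iIndepFun (fun (s : S) (y : S → Y) => y s) (Measure.pi ν) :=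
    iIndepFun_pi (X := fun _ y => y) fun _ => aemeasurable_id
  have hd : Disjoint A.toFinset B.toFinset := by simpa using hAB
  have h := hi.indepFun_finset _ _ hd fun s => measurable_pi_apply s
  -- Filling the coordinates outside D with y₀ makes each function factor through its own block of
  -- coordinates.
  let ext (D : Set S) (u : D.toFinset → Y) (s : S) : Y :=
    if h : s ∈ D.toFinset then u ⟨s, h⟩ else y₀
  have hext : ∀ D, Measurable (ext D) := by
    intro D
    refine measurable_pi_lambda _ fun s => ?_
    by_cases hs : s ∈ D.toFinset
    · simp only [ext, hs, dite_true]; exact measurable_pi_apply _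
    · simp only [ext, hs, dite_false]; exact measurable_const
  have h' := h.comp (hF.comp (hext A)) (hH.comp (hext B))
  have eF : F = (F ∘ ext A) ∘ fun (y : S → Y) (i : A.toFinset) => y i := by
    funext y
    exact hA fun s hs => by simp [ext, hs]
  have eH : H = (H ∘ ext B) ∘ fun (y : S → Y) (i : B.toFinset) => y i := by
    funext y
    exact hB fun s hs => by simp [ext, hs]
  rw [eF, eH]
  exact h'

lemma abs_softBit_le (m : ZMod 2 → ℝ≥0∞) : |softBit m| ≤ 1 := by
  have a : 0 ≤ (m 0).toReal := ENNReal.toReal_nonneg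
  have b : 0 ≤ (m 1).toReal := ENNReal.toReal_nonneg
  rw [softBit, abs_div, abs_of_nonneg (add_nonneg a b)]
  refine div_le_one_of_le₀ ?_ (add_nonneg a b)
  rw [abs_le]; constructor <;> linarith

/-! ### The channel and the initial messages. -/

section channel

variable {Y : Type*} [MeasurableSpace Y] (W : SymmetricChannel Y)

/-- The message which an output of the channel carries about its input. -/
noncomputable def posteriorMessage (y : Y) (b : ZMod 2) : ℝ≥0∞ := W.posterior b y

lemma measurable_posteriorMessage : Measurable (posteriorMessage W) :=
  measurable_pi_lambda _ fun _ => Measure.measurable_rnDeriv _ _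

lemma law_absolutelyContinuous (b : ZMod 2) : W.law b ≪ W.law 0 + W.law 1 := by
  have hz : b = 0 ∨ b = 1 := by revert b; decide
  rcases hz with rfl | rfl
  · exact Measure.absolutelyContinuous_of_le (Measure.le_add_right le_rfl)
  · exact Measure.absolutelyContinuous_of_le (Measure.le_add_left le_rfl)

lemma posterior_add_ae : ∀ᵐ y ∂W.law 0 + W.law 1, W.posterior 0 y + W.posterior 1 y = 1 := by
  have := W.prob
  filter_upwards [Measure.rnDeriv_add (W.law 0) (W.law 1) (W.law 0 + W.law 1),
    Measure.rnDeriv_self (W.law 0 + W.law 1)] with y h h'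
  rw [h', Pi.add_apply] at h
  exact h.symm

lemma proper_posteriorMessage_ae : ∀ᵐ y ∂W.law 0, Proper (posteriorMessage W y) := by
  have := W.prob
  have hf : ∀ b, ∀ᵐ y ∂W.law 0, W.posterior b y < ∞ := fun b =>
    (law_absolutelyContinuous W 0).ae_le (Measure.rnDeriv_lt_top _ _)
  filter_upwards [Measure.rnDeriv_pos (law_absolutelyContinuous W 0), hf 0, hf 1] with y h a b
  refine ⟨h.ne', fun c => ?_⟩
  have hz : c = 0 ∨ c = 1 := by revert c; decide
  rcases hz with rfl | rfl
  · exact a.ne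
  · exact b.ne

/-- The involution exchanges the two laws, so it preserves their sum and exchanges their densities
with respect to it. -/
lemma exists_involution : ∃ e : Y ≃ᵐ Y, (W.law 0 + W.law 1).map e = W.law 0 + W.law 1 ∧
    ∀ᵐ y ∂W.law 0 + W.law 1, W.posterior 0 (e y) = W.posterior 1 y ∧
      W.posterior 1 (e y) = W.posterior 0 y := by
  have := W.prob
  obtain ⟨f, hf, hi, h0, h1⟩ := W.symmetric
  let e : Y ≃ᵐ Y := ⟨hi.toPerm, hf, hf⟩
  have hν : (W.law 0 + W.law 1).map f = W.law 0 + W.law 1 := by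
    rw [Measure.map_add _ _ hf, h0, h1, add_comm]
  refine ⟨e, hν, ?_⟩
  have k0 := e.measurableEmbedding.rnDeriv_map (W.law 0) (W.law 0 + W.law 1)
  have k1 := e.measurableEmbedding.rnDeriv_map (W.law 1) (W.law 0 + W.law 1)
  have he : ⇑e = f := rfl
  rw [he, hν, h0] at k0
  rw [he, hν, h1] at k1
  filter_upwards [k0, k1] with y a b using ⟨b, a⟩

/-- With respect to the sum of the two laws, `law 0` has the density p = (1 + D) / 2 and `law 1` has
q = (1 - D) / 2. In p f(D) = p p f(D) + p q f(D) the involution fixes the weight p q and negates D,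
so f(D) may become f(-D) in the last term. -/
lemma symmetricLaw_posteriorMessage :
    SymmetricLaw (softLaw (W.law 0) (posteriorMessage W)) := by
  have := W.prob
  have hmp := measurable_posteriorMessage W
  have hm : Measurable fun y => softBit (posteriorMessage W y) := measurable_softBit.comp hmp
  refine ⟨Measure.isProbabilityMeasure_map hm.aemeasurable, ?_, ?_⟩
  · refine (ae_map_iff hm.aemeasurable (measurableSet_le (by fun_prop) (by fun_prop))).2 ?_
    exact Filter.Eventually.of_forall fun y => abs_softBit_le _
  rintro f hf ⟨K, hK⟩
  rw [softLaw, integral_map hm.aemeasurable hf.aestronglyMeasurable,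
    integral_map hm.aemeasurable (by fun_prop)]
  set ν := W.law 0 + W.law 1 with hν
  set D : Y → ℝ := fun y => softBit (posteriorMessage W y) with hD
  set p : Y → ℝ := fun y => (W.posterior 0 y).toReal with hp
  set q : Y → ℝ := fun y => (W.posterior 1 y).toReal with hq
  have hpm : Measurable p := (Measure.measurable_rnDeriv _ _).ennreal_toReal
  have hqm : Measurable q := (Measure.measurable_rnDeriv _ _).ennreal_toReal
  have hadd : ∀ᵐ y ∂ν, p y + q y = 1 := by
    filter_upwards [posterior_add_ae W] with y h
    have h0 : W.posterior 0 y ≠ ∞ := fun e => by simp [e] at h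
    have h1 : W.posterior 1 y ≠ ∞ := fun e => by simp [e] at h
    rw [hp, hq, ← ENNReal.toReal_add h0 h1, h, ENNReal.toReal_one]
  have hDpq : ∀ y, p y + q y = 1 → D y = p y - q y := by
    intro y h
    change (p y - q y) / (p y + q y) = _
    rw [h, div_one]
  have hp0 : ∀ y, 0 ≤ p y := fun y => ENNReal.toReal_nonneg
  have hq0 : ∀ y, 0 ≤ q y := fun y => ENNReal.toReal_nonneg
  have hdens : ∀ g : Y → ℝ, ∫ y, g y ∂W.law 0 = ∫ y, p y * g y ∂ν := fun g =>
    (integral_rnDeriv_smul (law_absolutelyContinuous W 0)).symm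
  have hbd : ∀ y, |f (D y)| ≤ K ∧ |f (-D y)| ≤ K := fun y =>
    ⟨hK _ (abs_softBit_le _), hK _ (by rw [abs_neg]; exact abs_softBit_le _)⟩
  have hint : ∀ g : Y → ℝ, Measurable g → (∀ y, |g y| ≤ K) → ∀ r : Y → ℝ, Measurable r →
      (∀ y, 0 ≤ r y) → (∀ y, p y + q y = 1 → r y ≤ 1) →
      Integrable (fun y => p y * (r y * g y)) ν := by
    intro g hg hgK r hr hr0 hr1
    refine Integrable.of_bound (by fun_prop) K ?_
    filter_upwards [hadd] with y h
    have h1 := hr1 y h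
    have h2 : p y ≤ 1 := by linarith [hq0 y]
    rw [Real.norm_eq_abs, abs_mul, abs_mul, abs_of_nonneg (hp0 y), abs_of_nonneg (hr0 y)]
    calc p y * (r y * |g y|) ≤ 1 * (1 * |g y|) := by
          have := hp0 y; have := hr0 y; gcongr
      _ ≤ K := by simpa using hgK y
  have hq1 : ∀ y, p y + q y = 1 → q y ≤ 1 := fun y h => by linarith [hp0 y]
  have hp1 : ∀ y, p y + q y = 1 → p y ≤ 1 := fun y h => by linarith [hq0 y]
  have i1 := hint (fun y => f (D y)) (by fun_prop) (fun y => (hbd y).1) p hpm hp0 hp1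
  have i2 := hint (fun y => f (D y)) (by fun_prop) (fun y => (hbd y).1) q hqm hq0 hq1
  have i3 := hint (fun y => f (-D y)) (by fun_prop) (fun y => (hbd y).2) q hqm hq0 hq1
  have hswap : ∫ y, p y * (q y * f (-D y)) ∂ν = ∫ y, p y * (q y * f (D y)) ∂ν := by
    obtain ⟨e, he, hpost⟩ := exists_involution W
    nth_rw 1 [hν, ← he]
    rw [integral_map_equiv]
    refine integral_congr_ae ?_
    filter_upwards [hpost, hadd] with y hy hy1
    have a : p (e y) = q y := congrArg ENNReal.toReal hy.1
    have b : q (e y) = p y := congrArg ENNReal.toReal hy.2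
    have c : -D (e y) = D y := by
      rw [hDpq y hy1, hDpq (e y) (by rw [a, b, add_comm]; exact hy1), a, b]; ring
    rw [a, b, c]; ring
  rw [hdens, hdens]
  calc ∫ y, p y * f (D y) ∂ν = ∫ y, p y * (p y * f (D y)) + p y * (q y * f (D y)) ∂ν := by
        refine integral_congr_ae ?_
        filter_upwards [hadd] with y h
        linear_combination -(p y * f (D y)) * h
    _ = ∫ y, p y * (p y * f (D y)) + p y * (q y * f (-D y)) ∂ν := by
        rw [integral_add i1 i2, integral_add i1 i3, hswap]
    _ = _ := by
        refine integral_congr_ae ?_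
        filter_upwards [hadd] with y h
        have e := hDpq y h
        have e1 : p y = (1 + D y) / 2 := by linarith
        have e2 : q y = (1 - D y) / 2 := by linarith
        linear_combination p y * f (D y) * e1 + p y * f (-D y) * e2

variable {S : Type*} (P : Set S)

lemma measurable_initialMessage (s : S) :
    Measurable fun y : S → Y => initialMessage W P y s := by
  unfold initialMessage
  split_ifs
  · exact measurable_const
  · exact (measurable_posteriorMessage W).comp (measurable_pi_apply s)

lemma dependsOn_initialMessage (s : S) :
    DependsOn (fun y : S → Y => initialMessage W P y s) {s} := by
  intro y y' h
  have := h s rfl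
  funext b
  simp only [initialMessage, this]

lemma initialMessage_of_mem {s : S} (h : s ∈ P) (y : S → Y) :
    initialMessage W P y s = fun _ => 1 / 2 := by
  funext b; simp [initialMessage, h]

lemma initialMessage_of_notMem {s : S} (h : s ∉ P) (y : S → Y) :
    initialMessage W P y s = posteriorMessage W (y s) := by
  funext b; simp [initialMessage, h, posteriorMessage]

variable [Fintype S]

/-- The distribution of the channel outputs when the all-zero codeword is sent. -/
noncomputable def zeroLaw (S : Type*) [Fintype S] : Measure (S → Y) :=
  Measure.pi fun _ => W.law 0

instance : IsProbabilityMeasure (zeroLaw W S) := by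
  have := W.prob
  unfold zeroLaw; infer_instance

lemma proper_initialMessage_ae (s : S) :
    ∀ᵐ y ∂zeroLaw W S, Proper (initialMessage W P y s) := by
  have := W.prob
  by_cases h : s ∈ P
  · refine Filter.Eventually.of_forall fun y => ?_
    rw [initialMessage_of_mem W P h]
    exact ⟨by simp, fun _ => by simp⟩
  · simp only [initialMessage_of_notMem W P h]
    exact (Measure.quasiMeasurePreserving_eval (fun _ => W.law 0) s).ae
      (proper_posteriorMessage_ae W)

lemma softLaw_initialMessage_of_mem {s : S} (h : s ∈ P) :
    softLaw (zeroLaw W S) (fun y => initialMessage W P y s) = Measure.dirac 0 := by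
  simp only [softLaw, initialMessage_of_mem W P h, softBit, sub_self, zero_div, Measure.map_const,
    measure_univ, one_smul]

lemma softLaw_initialMessage_of_notMem {s : S} (h : s ∉ P) :
    softLaw (zeroLaw W S) (fun y => initialMessage W P y s) =
      softLaw (W.law 0) (posteriorMessage W) := by
  have := W.prob
  have e := (measurePreserving_eval (fun _ : S => W.law 0) s).map_eq
  simp only [softLaw, initialMessage_of_notMem W P h]
  have hm : Measurable fun y => softBit (posteriorMessage W y) :=
    measurable_softBit.comp (measurable_posteriorMessage W)
  conv_rhs => rw [← e]
  rw [Measure.map_map hm (measurable_pi_apply s)]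
  rfl

lemma symmetricLaw_initialMessage (s : S) :
    SymmetricLaw (softLaw (zeroLaw W S) fun y => initialMessage W P y s) := by
  by_cases h : s ∈ P
  · rw [softLaw_initialMessage_of_mem W P h]; exact symmetricLaw_dirac_zero
  · rw [softLaw_initialMessage_of_notMem W P h]; exact symmetricLaw_posteriorMessage W

/-- The initial law depends only on whether the symbol is punctured, so nodes of the same kind start
alike, even in different graphs. -/
lemma softLaw_initialMessage_congr {S' : Type*} [Fintype S'] {P' : Set S'} {s : S} {s' : S'}
    (h : s ∈ P ↔ s' ∈ P') :
    softLaw (zeroLaw W S) (fun y => initialMessage W P y s) =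
      softLaw (zeroLaw W S') fun y => initialMessage W P' y s' := by
  by_cases hs : s ∈ P
  · rw [softLaw_initialMessage_of_mem W P hs, softLaw_initialMessage_of_mem W P' (h.1 hs)]
  · rw [softLaw_initialMessage_of_notMem W P hs,
      softLaw_initialMessage_of_notMem W P' (mt h.2 hs)]

end channel

/-! ### Leveled forests and disjointness of subtrees. -/

/-- A forest with levels: adjacent nodes lie in consecutive levels, and a node has at most one
neighbour in the level above it. -/
structure IsLeveled {V : Type*} (H : SimpleGraph V) (d : V → ℕ) : Prop where
  level : ∀ ⦃a b⦄, H.Adj a b → d a = d b + 1 ∨ d b = d a + 1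
  parent : ∀ ⦃a b b'⦄, H.Adj b a → H.Adj b' a → d a = d b + 1 → d a = d b' + 1 → b = b'

/-- `w` is a neighbour of `u` in the next level. -/
def Below {V : Type*} (H : SimpleGraph V) (d : V → ℕ) (u w : V) : Prop :=
  H.Adj u w ∧ d w = d u + 1

section levels

variable {V : Type*} {H : SimpleGraph V} {d : V → ℕ}

lemma level_le_of_below {u w : V} (h : Relation.ReflTransGen (Below H d) u w) : d u ≤ d w := by
  induction h with
  | refl => exact le_rfl
  | tail _ h ih => have := h.2; omega

/-- Climbing from w along unique parents shows that w has at most one ancestor on each level.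
Subtrees hanging from distinct nodes of one level are therefore disjoint, the source of all
independence below. -/
lemma IsLeveled.eq_of_below (hd : IsLeveled H d) {u u' w : V}
    (h : Relation.ReflTransGen (Below H d) u w) (h' : Relation.ReflTransGen (Below H d) u' w)
    (e : d u = d u') : u = u' := by
  induction h with
  | refl =>
    rcases h'.cases_tail with rfl | ⟨p, hp, hpw⟩
    · rfl
    · have := level_le_of_below hp
      have := hpw.2
      omega
  | @tail p q hp hpq ih =>
    rcases h'.cases_tail with rfl | ⟨p', hp', hpq'⟩
    · have := level_le_of_below hp
      have := hpq.2
      omega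
    · have : p = p' := hd.parent hpq.1 hpq'.1 hpq.2 hpq'.2
      subst this
      exact ih hp'

end levels

section dependence

variable {S Y ι β : Type*} [CommMonoid β]

lemma dependsOn_prod {Z : ι → (S → Y) → β} {D : ι → Set S} (h : ∀ i, DependsOn (Z i) (D i))
    (A : Finset ι) : DependsOn (∏ i ∈ A, Z i) (⋃ i ∈ A, D i) := by
  intro y y' hy
  rw [Finset.prod_apply, Finset.prod_apply]
  exact Finset.prod_congr rfl fun i hi => h i fun s hs => hy s (Set.mem_biUnion hi hs)

lemma indepFun_prod_prod [Fintype S] [MeasurableSpace Y] [MeasurableSpace β] [MeasurableMul₂ β]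
    (ν : S → Measure Y) [∀ s, IsProbabilityMeasure (ν s)] {Z : ι → (S → Y) → β}
    (hZ : ∀ i, Measurable (Z i)) {D : ι → Set S} (h : ∀ i, DependsOn (Z i) (D i))
    (hD : ∀ i j, i ≠ j → Disjoint (D i) (D j)) {A B : Finset ι} (hAB : Disjoint A B) :
    IndepFun (∏ i ∈ A, Z i) (∏ i ∈ B, Z i) (Measure.pi ν) := by
  have hm : ∀ A : Finset ι, Measurable (∏ i ∈ A, Z i) := fun A =>
    Finset.prod_induction _ Measurable (fun _ _ => Measurable.mul) measurable_one fun i _ => hZ i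
  refine indepFun_of_dependsOn ν (hm A) (hm B) (dependsOn_prod h A) (dependsOn_prod h B) ?_
  refine Set.disjoint_iUnion₂_left.2 fun i hi => Set.disjoint_iUnion₂_right.2 fun j hj => ?_
  exact hD i j fun e => Finset.disjoint_left.1 hAB hi (e ▸ hj)

lemma indepFun_prod [Fintype S] [MeasurableSpace Y] [MeasurableSpace β] [MeasurableMul₂ β]
    (ν : S → Measure Y) [∀ s, IsProbabilityMeasure (ν s)] {Z : ι → (S → Y) → β}
    (hZ : ∀ i, Measurable (Z i)) {D : ι → Set S} (h : ∀ i, DependsOn (Z i) (D i))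
    (hD : ∀ i j, i ≠ j → Disjoint (D i) (D j)) (A : Finset ι) (i : ι) (hi : i ∉ A) :
    IndepFun (Z i) (∏ j ∈ A, Z j) (Measure.pi ν) := by
  have := indepFun_prod_prod ν hZ h hD (Finset.disjoint_singleton_left.2 hi)
  rwa [Finset.prod_singleton] at this

end dependence

variable {S C : Type*}

/-- The symbols which are children of the check `c`. -/
abbrev SymbolChild (T : TannerGraph S C) (d : S ⊕ C → ℕ) (c : C) : Type _ :=
  {w : S // T.edge w c ∧ d (.inl w) = d (.inr c) + 1}

/-- The checks which are children of the symbol `s`. -/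
abbrev CheckChild (T : TannerGraph S C) (d : S ⊕ C → ℕ) (s : S) : Type _ :=
  {c : C // T.edge s c ∧ d (.inr c) = d (.inl s) + 1}

section below

variable (T : TannerGraph S C) (d : S ⊕ C → ℕ)

/-- The symbols which are descendants of a node. -/
def symbolsBelow (u : S ⊕ C) : Set S :=
  {w | Relation.ReflTransGen (Below T.graph d) u (.inl w)}

lemma symbolsBelow_subset {u u' : S ⊕ C} (h : Below T.graph d u u') :
    symbolsBelow T d u' ⊆ symbolsBelow T d u := fun _ hw => Relation.ReflTransGen.head h hw

variable {T d}

lemma SymbolChild.below {c : C} (w : SymbolChild T d c) :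
    Below T.graph d (.inr c) (.inl w.1) := ⟨Or.inr ⟨_, _, rfl, rfl, w.2.1⟩, w.2.2⟩

lemma CheckChild.below {s : S} (c : CheckChild T d s) :
    Below T.graph d (.inl s) (.inr c.1) := ⟨Or.inl ⟨_, _, rfl, rfl, c.2.1⟩, c.2.2⟩

lemma IsLeveled.disjoint_symbolsBelow (hd : IsLeveled T.graph d) {u u' : S ⊕ C}
    (e : d u = d u') (hne : u ≠ u') : Disjoint (symbolsBelow T d u) (symbolsBelow T d u') :=
  Set.disjoint_left.2 fun _ h h' => hne (hd.eq_of_below h h' e)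

lemma IsLeveled.disjoint_symbolChild (hd : IsLeveled T.graph d) {c : C}
    (w w' : SymbolChild T d c) (h : w ≠ w') :
    Disjoint (symbolsBelow T d (.inl w.1)) (symbolsBelow T d (.inl w'.1)) :=
  hd.disjoint_symbolsBelow (w.2.2.trans w'.2.2.symm)
    fun e => h (Subtype.ext (Sum.inl_injective e))

lemma IsLeveled.disjoint_checkChild (hd : IsLeveled T.graph d) {s : S}
    (c c' : CheckChild T d s) (h : c ≠ c') :
    Disjoint (symbolsBelow T d (.inr c.1)) (symbolsBelow T d (.inr c'.1)) :=
  hd.disjoint_symbolsBelow (c.2.2.trans c'.2.2.symm)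
    fun e => h (Subtype.ext (Sum.inr_injective e))

end below

variable [Fintype S] [Fintype C]

noncomputable instance (T : TannerGraph S C) (d : S ⊕ C → ℕ) (c : C) :
    Fintype (SymbolChild T d c) := Fintype.ofFinite _

noncomputable instance (T : TannerGraph S C) (d : S ⊕ C → ℕ) (s : S) :
    Fintype (CheckChild T d s) := Fintype.ofFinite _

noncomputable instance (T : TannerGraph S C) (d : S ⊕ C → ℕ) (c : C) :
    DecidableEq (SymbolChild T d c) := Classical.decEq _

noncomputable instance (T : TannerGraph S C) (d : S ⊕ C → ℕ) (s : S) :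
    DecidableEq (CheckChild T d s) := Classical.decEq _

/-! ### The upward recursion and its laws. -/

/-- The message which a symbol sends upwards after `t` iterations: its initial message and the
messages of its children. -/
noncomputable def upward (T : TannerGraph S C) (d : S ⊕ C → ℕ) (ini : S → ZMod 2 → ℝ≥0∞) :
    ℕ → S → ZMod 2 → ℝ≥0∞
  | 0, s => ini s
  | t + 1, s => ini s * ∏ c : CheckChild T d s,
      parityMessage fun w : SymbolChild T d c.1 => upward T d ini t w.1

/-- The message which a check sends upwards. -/
noncomputable def upwardCheck (T : TannerGraph S C) (d : S ⊕ C → ℕ) (ini : S → ZMod 2 → ℝ≥0∞)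
    (t : ℕ) (c : C) : ZMod 2 → ℝ≥0∞ :=
  parityMessage fun w : SymbolChild T d c => upward T d ini t w.1

lemma upward_succ (T : TannerGraph S C) (d : S ⊕ C → ℕ) (ini : S → ZMod 2 → ℝ≥0∞) (t : ℕ)
    (s : S) : upward T d ini (t + 1) s =
      ini s * ∏ c : CheckChild T d s, upwardCheck T d ini t c.1 := by
  rw [upward]; rfl

lemma proper_upward {T : TannerGraph S C} {d : S ⊕ C → ℕ} {ini : S → ZMod 2 → ℝ≥0∞}
    (h : ∀ s, Proper (ini s)) (t : ℕ) : ∀ s, Proper (upward T d ini t s) := by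
  induction t with
  | zero => intro s; exact h s
  | succ t ih =>
    intro s
    rw [upward]
    exact (h s).mul (Proper.prod fun c _ => Proper.parityMessage fun w => ih w.1)

lemma proper_upwardCheck {T : TannerGraph S C} {d : S ⊕ C → ℕ} {ini : S → ZMod 2 → ℝ≥0∞}
    (h : ∀ s, Proper (ini s)) (t : ℕ) (c : C) : Proper (upwardCheck T d ini t c) :=
  Proper.parityMessage fun w => proper_upward h t w.1

section random

variable {Y : Type*} [MeasurableSpace Y] (W : SymmetricChannel Y) (P : Set S)
  (T : TannerGraph S C) (d : S ⊕ C → ℕ)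

lemma proper_initialMessage_forall_ae :
    ∀ᵐ y ∂zeroLaw W S, ∀ s, Proper (initialMessage W P y s) :=
  ae_all_iff.2 fun s => proper_initialMessage_ae W P s

lemma measurable_upward (t : ℕ) :
    ∀ s, Measurable fun y : S → Y => upward T d (initialMessage W P y) t s := by
  induction t with
  | zero => intro s; exact measurable_initialMessage W P s
  | succ t ih =>
    intro s
    simp only [upward]
    refine (measurable_initialMessage W P s).mul (Finset.measurable_fun_prod _ fun c _ => ?_)
    exact measurable_parityMessage.comp (measurable_pi_lambda _ fun w => ih w.1)

lemma measurable_upwardCheck (t : ℕ) (c : C) :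
    Measurable fun y : S → Y => upwardCheck T d (initialMessage W P y) t c :=
  measurable_parityMessage.comp (measurable_pi_lambda _ fun w => measurable_upward W P T d t w.1)

variable {T d}

lemma dependsOn_upward (t : ℕ) : ∀ s, DependsOn
    (fun y : S → Y => upward T d (initialMessage W P y) t s) (symbolsBelow T d (.inl s)) := by
  have hi : ∀ s, DependsOn (fun y : S → Y => initialMessage W P y s)
      (symbolsBelow T d (.inl s)) := fun s =>
    (dependsOn_initialMessage W P s).mono (by
      rintro _ rfl; exact Relation.ReflTransGen.refl)
  induction t with
  | zero => exact hi
  | succ t ih =>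
    intro s y y' h
    simp only [upward]
    congr 1
    · exact hi s h
    · refine Finset.prod_congr rfl fun c _ => congrArg _ (funext fun w => ih w.1 fun i hi => ?_)
      exact h i (symbolsBelow_subset T d c.below (symbolsBelow_subset T d w.below hi))

lemma dependsOn_upwardCheck (t : ℕ) (c : C) : DependsOn
    (fun y : S → Y => upwardCheck T d (initialMessage W P y) t c)
    (symbolsBelow T d (.inr c)) := by
  intro y y' h
  refine congrArg parityMessage (funext fun w : SymbolChild T d c =>
    dependsOn_upward W P t w.1 fun i hi => ?_)
  exact h i (symbolsBelow_subset T d w.below hi)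

variable (T d)

/-- The soft bit which a symbol sends upwards, as a function of the channel outputs. -/
noncomputable def upwardSoft (t : ℕ) (s : S) (y : S → Y) : ℝ :=
  softBit (upward T d (initialMessage W P y) t s)

/-- The message which a check sends upwards, as a function of the channel outputs. -/
noncomputable def upwardCheckAt (t : ℕ) (c : C) (y : S → Y) : ZMod 2 → ℝ≥0∞ :=
  upwardCheck T d (initialMessage W P y) t c

/-- The law of the soft bit which a symbol sends upwards. -/
noncomputable def upwardLaw (t : ℕ) (s : S) : Measure ℝ :=
  softLaw (zeroLaw W S) fun y => upward T d (initialMessage W P y) t s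

/-- The law of the soft bit which a check sends upwards. -/
noncomputable def upwardCheckLaw (t : ℕ) (c : C) : Measure ℝ :=
  softLaw (zeroLaw W S) (upwardCheckAt W P T d t c)

variable {T d}

lemma measurable_upwardSoft (t : ℕ) (s : S) : Measurable (upwardSoft W P T d t s) :=
  measurable_softBit.comp (measurable_upward W P T d t s)

lemma indepFun_upwardSoft (hd : IsLeveled T.graph d) (t : ℕ) (c : C)
    (A : Finset (SymbolChild T d c)) (w : SymbolChild T d c) (hw : w ∉ A) :
    IndepFun (upwardSoft W P T d t w.1) (∏ j ∈ A, upwardSoft W P T d t j.1) (zeroLaw W S) := by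
  have := W.prob
  exact indepFun_prod _ (Z := fun j : SymbolChild T d c => upwardSoft W P T d t j.1)
    (fun j => measurable_upwardSoft W P t j.1)
    (fun j y y' h => congrArg softBit (dependsOn_upward W P t j.1 h)) hd.disjoint_symbolChild A w hw

lemma indepFun_upwardCheck (hd : IsLeveled T.graph d) (t : ℕ) (s : S)
    {A B : Finset (CheckChild T d s)} (hAB : Disjoint A B) :
    IndepFun (∏ c ∈ A, upwardCheckAt W P T d t c.1) (∏ c ∈ B, upwardCheckAt W P T d t c.1)
      (zeroLaw W S) := by
  have := W.prob
  exact indepFun_prod_prod _ (Z := fun c : CheckChild T d s => upwardCheckAt W P T d t c.1) (fun c => measurable_upwardCheck W P T d t c.1)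
    (fun c => dependsOn_upwardCheck W P t c.1) hd.disjoint_checkChild hAB

lemma indepFun_upwardCheck_single (hd : IsLeveled T.graph d) (t : ℕ) (s : S)
    (A : Finset (CheckChild T d s)) (c : CheckChild T d s) (hc : c ∉ A) :
    IndepFun (upwardCheckAt W P T d t c.1) (∏ c ∈ A, upwardCheckAt W P T d t c.1)
      (zeroLaw W S) := by
  have := indepFun_upwardCheck W P hd t s (Finset.disjoint_singleton_left.2 hc)
  rwa [Finset.prod_singleton] at this

lemma upwardCheckLaw_eq (t : ℕ) (c : C) :
    upwardCheckLaw W P T d t c =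
      (zeroLaw W S).map (∏ w : SymbolChild T d c, upwardSoft W P T d t w.1) := by
  refine Measure.map_congr ?_
  filter_upwards [proper_initialMessage_forall_ae W P] with y h
  rw [Finset.prod_apply]
  exact softBit_parityMessage fun w => proper_upward h t w.1

lemma measurable_prod_upwardCheckAt {s : S} (t : ℕ) (A : Finset (CheckChild T d s)) :
    Measurable (∏ c ∈ A, upwardCheckAt W P T d t c.1) :=
  Finset.prod_induction _ Measurable (fun _ _ => Measurable.mul) measurable_one
    fun c _ => measurable_upwardCheck W P T d t c.1

lemma proper_prod_upwardCheckAt {s : S} (t : ℕ) (A : Finset (CheckChild T d s)) :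
    ∀ᵐ y ∂zeroLaw W S, Proper ((∏ c ∈ A, upwardCheckAt W P T d t c.1) y) := by
  filter_upwards [proper_initialMessage_forall_ae W P] with y h
  rw [Finset.prod_apply]
  exact Proper.prod fun c _ => proper_upwardCheck h t c.1

lemma upwardLaw_succ (t : ℕ) (s : S) :
    upwardLaw W P T d (t + 1) s =
      combineLaw (softLaw (zeroLaw W S) fun y => initialMessage W P y s)
        (softLaw (zeroLaw W S) (∏ c : CheckChild T d s, upwardCheckAt W P T d t c.1)) := by
  have := W.prob
  rw [← softLaw_mul (measurable_initialMessage W P s) (measurable_prod_upwardCheckAt W P t _)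
    (proper_initialMessage_ae W P s) (proper_prod_upwardCheckAt W P t _)]
  · rw [upwardLaw]
    congr 1
    funext y
    rw [upward_succ, Pi.mul_apply, Finset.prod_apply]
    rfl
  · have hD := dependsOn_prod (Z := fun c : CheckChild T d s => upwardCheckAt W P T d t c.1)
      (fun c => dependsOn_upwardCheck W P t c.1) Finset.univ
    refine indepFun_of_dependsOn _ (measurable_initialMessage W P s)
      (measurable_prod_upwardCheckAt W P t _) (dependsOn_initialMessage W P s) hD ?_
    -- Descendants of a child check lie strictly below s, so the output of s itself does not enter
    -- the messages of its children.
    refine Set.disjoint_singleton_left.2 fun h => ?_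
    obtain ⟨c, -, hc⟩ := Set.mem_iUnion₂.1 h
    have h1 := level_le_of_below hc
    have h2 := c.2.2
    omega

lemma symmetricLaw_upwardCheckLaw (hd : IsLeveled T.graph d) (t : ℕ)
    (h : ∀ s, SymmetricLaw (upwardLaw W P T d t s)) (c : C) :
    SymmetricLaw (upwardCheckLaw W P T d t c) := by
  rw [upwardCheckLaw_eq]
  exact symmetricLaw_map_prod (X := fun w : SymbolChild T d c => upwardSoft W P T d t w.1)
    (fun w => measurable_upwardSoft W P t w.1)
    (indepFun_upwardSoft W P hd t c) (fun w => h w.1) _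

lemma symmetricLaw_prod_upwardCheckAt (hd : IsLeveled T.graph d) (t : ℕ)
    (h : ∀ s, SymmetricLaw (upwardLaw W P T d t s)) (s : S)
    (A : Finset (CheckChild T d s)) :
    SymmetricLaw (softLaw (zeroLaw W S) (∏ c ∈ A, upwardCheckAt W P T d t c.1)) :=
  symmetricLaw_softLaw_prod (Z := fun c : CheckChild T d s => upwardCheckAt W P T d t c.1)
    (fun c => measurable_upwardCheck W P T d t c.1)
    (fun c => (proper_initialMessage_forall_ae W P).mono fun _ h => proper_upwardCheck h t c.1)
    (indepFun_upwardCheck_single W P hd t s)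
    (fun c => symmetricLaw_upwardCheckLaw W P hd t h c.1) A

lemma symmetricLaw_upwardLaw (hd : IsLeveled T.graph d) (t : ℕ) :
    ∀ s, SymmetricLaw (upwardLaw W P T d t s) := by
  induction t with
  | zero => exact symmetricLaw_initialMessage W P
  | succ t ih =>
    intro s
    rw [upwardLaw_succ W P]
    exact (symmetricLaw_initialMessage W P s).combineLaw
      (symmetricLaw_prod_upwardCheckAt W P hd t ih s _)

end random

lemma combineLaw_dirac_zero (ρ : Measure ℝ) [SFinite ρ] :
    combineLaw ρ (Measure.dirac 0) = ρ := by
  rw [combineLaw, Measure.prod_dirac, Measure.map_map measurable_combine (by fun_prop)]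
  have : ((fun p : ℝ × ℝ => combine p.1 p.2) ∘ fun x => (x, 0)) = id := by
    funext x; simp [combine]
  rw [this, Measure.map_id]

/-- Combining with the point mass at 0 changes nothing, and any symmetric σ dominates that point
mass. This absorbs additional checks. -/
lemma degraded_combineLaw {ρ σ : Measure ℝ} (hρ : SymmetricLaw ρ) (hσ : SymmetricLaw σ) :
    Degraded ρ (combineLaw ρ σ) := by
  have := hρ.prob
  have h := (Degraded.refl ρ).combineLaw hρ hρ symmetricLaw_dirac_zero hσ (degraded_dirac_zero hσ)
  rwa [combineLaw_dirac_zero] at h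

/-! ### Comparison of two forests along a partial embedding. -/

section comparison

variable {S' C' Y : Type*} [Fintype S'] [Fintype C'] [MeasurableSpace Y]

/-- A partial embedding of a rooted forest of symbols and checks into another one, under which a
check has the same children in both and a symbol may have further children in the second one. -/
structure PartialEmbedding (T : TannerGraph S C) (d : S ⊕ C → ℕ) (P : Set S)
    (T' : TannerGraph S' C') (d' : S' ⊕ C' → ℕ) (P' : Set S') (RS : S → S' → Prop)
    (RC : C → C' → Prop) : Prop where
  mem_iff : ∀ s s', RS s s' → (s ∈ P ↔ s' ∈ P')
  injS : ∀ s t s', RS s s' → RS t s' → s = t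
  uniqueS : ∀ s s' t', RS s s' → RS s t' → s' = t'
  injC : ∀ c e c', RC c c' → RC e c' → c = e
  checkChild : ∀ s s', RS s s' → ∀ c : CheckChild T d s, ∃ c' : CheckChild T' d' s', RC c.1 c'.1
  symbolChild : ∀ c c', RC c c' → ∀ w : SymbolChild T d c, ∃ w' : SymbolChild T' d' c',
    RS w.1 w'.1
  symbolChild_surj : ∀ c c', RC c c' → ∀ w' : SymbolChild T' d' c', ∃ w : SymbolChild T d c,
    RS w.1 w'.1

/-- At a check the children correspond bijectively, so `mulLaw` is applied to matching factors. At a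
symbol the matched checks are compared one by one and the surplus ones can only improve the message.
-/
lemma degraded_upwardLaw (W : SymmetricChannel Y) {T : TannerGraph S C} {d : S ⊕ C → ℕ}
    {P : Set S} {T' : TannerGraph S' C'} {d' : S' ⊕ C' → ℕ} {P' : Set S'} {RS : S → S' → Prop}
    {RC : C → C' → Prop} (h : PartialEmbedding T d P T' d' P' RS RC) (hd : IsLeveled T.graph d)
    (hd' : IsLeveled T'.graph d') (t : ℕ) :
    ∀ s s', RS s s' → Degraded (upwardLaw W P T d t s) (upwardLaw W P' T' d' t s') := by
  induction t with
  | zero =>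
    intro s s' hs
    simp only [upwardLaw, upward]
    rw [softLaw_initialMessage_congr W P (h.mem_iff s s' hs)]
    exact Degraded.refl _
  | succ t ih =>
    have hsym := symmetricLaw_upwardLaw W P hd t
    have hsym' := symmetricLaw_upwardLaw W P' hd' t
    have hcheck : ∀ c c', RC c c' →
        Degraded (upwardCheckLaw W P T d t c) (upwardCheckLaw W P' T' d' t c') := by
      intro c c' hc
      choose e he using h.symbolChild c c' hc
      have hb : Function.Bijective e := by
        refine ⟨fun w w₁ hw => Subtype.ext (h.injS _ _ _ (he w) (hw ▸ he w₁)), fun w' => ?_⟩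
        obtain ⟨w, hw⟩ := h.symbolChild_surj c c' hc w'
        exact ⟨w, Subtype.ext (h.uniqueS _ _ _ (he w) hw)⟩
      rw [upwardCheckLaw_eq, upwardCheckLaw_eq,
        ← hb.prod_comp fun w : SymbolChild T' d' c' => upwardSoft W P' T' d' t w.1]
      refine degraded_map_prod (X := fun w : SymbolChild T d c => upwardSoft W P T d t w.1)
        (X' := fun w : SymbolChild T d c => upwardSoft W P' T' d' t (e w).1) (fun w => measurable_upwardSoft W P t w.1)
        (fun w => measurable_upwardSoft W P' t (e w).1) (indepFun_upwardSoft W P hd t c) ?_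
        (fun w => hsym w.1) (fun w => hsym' (e w).1) (fun w => ih _ _ (he w)) _
      intro A w hw
      have := indepFun_upwardSoft W P' hd' t c' (A.map ⟨e, hb.1⟩) (e w) (by
        simpa [hb.1.eq_iff] using hw)
      rwa [Finset.prod_map] at this
    intro s s' hs
    choose e he using h.checkChild s s' hs
    have hinj : Function.Injective e := fun c c₁ hc =>
      Subtype.ext (h.injC _ _ _ (he c) (hc ▸ he c₁))
    rw [upwardLaw_succ W P, upwardLaw_succ W P',
      softLaw_initialMessage_congr W P (h.mem_iff s s' hs)]
    have hA := symmetricLaw_prod_upwardCheckAt W P hd t hsym s Finset.univ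
    have hA' := symmetricLaw_prod_upwardCheckAt W P' hd' t hsym' s'
    refine (Degraded.refl _).combineLaw (symmetricLaw_initialMessage W P' s')
      (symmetricLaw_initialMessage W P' s') hA (hA' Finset.univ) ?_
    have hd1 : Degraded
        (softLaw (zeroLaw W S) (∏ c : CheckChild T d s, upwardCheckAt W P T d t c.1))
        (softLaw (zeroLaw W S') (∏ c ∈ Finset.univ.map ⟨e, hinj⟩,
          upwardCheckAt W P' T' d' t c.1)) := by
      rw [Finset.prod_map]
      refine degraded_softLaw_prod
        (Z := fun c : CheckChild T d s => upwardCheckAt W P T d t c.1)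
        (Z' := fun c : CheckChild T d s => upwardCheckAt W P' T' d' t (e c).1) (fun c => measurable_upwardCheck W P T d t c.1)
        (fun c => (proper_initialMessage_forall_ae W P).mono
          fun _ h => proper_upwardCheck h t c.1)
        (indepFun_upwardCheck_single W P hd t s)
        (fun c => symmetricLaw_upwardCheckLaw W P hd t hsym c.1)
        (fun c => measurable_upwardCheck W P' T' d' t (e c).1)
        (fun c => (proper_initialMessage_forall_ae W P').mono
          fun _ h => proper_upwardCheck h t (e c).1) ?_
        (fun c => symmetricLaw_upwardCheckLaw W P' hd' t hsym' (e c).1)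
        (fun c => hcheck _ _ (he c)) _
      intro A c hc
      have := indepFun_upwardCheck_single W P' hd' t s' (A.map ⟨e, hinj⟩) (e c) (by
        simpa [hinj.eq_iff] using hc)
      rwa [Finset.prod_map] at this
    refine hd1.trans ?_
    -- The children of s' split into matched and additional checks, whose message products are
    -- independent.
    rw [← Finset.prod_mul_prod_compl (Finset.univ.map ⟨e, hinj⟩)
        fun c : CheckChild T' d' s' => upwardCheckAt W P' T' d' t c.1,
      softLaw_mul (measurable_prod_upwardCheckAt W P' t _)
        (measurable_prod_upwardCheckAt W P' t _) (proper_prod_upwardCheckAt W P' t _)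
        (proper_prod_upwardCheckAt W P' t _)
        (indepFun_upwardCheck W P' hd' t s' disjoint_compl_right)]
    exact degraded_combineLaw (hA' _) (hA' _)

end comparison

/-- A root-preserving isomorphism keeps levels. If the image of u lay above the image of its parent
p, it would be the parent of that image, which is the image of the grandparent of u; injectivity
forbids this. The induction bounds the level by n because it reaches back two levels. -/
lemma level_apply_iso {V V' : Type*} {H : SimpleGraph V} {H' : SimpleGraph V'}
    {d : V → ℕ} {d' : V' → ℕ} (hd' : IsLeveled H' d') {N : Set V}
    {N' : Set V'} (φ : H.induce N ≃g H'.induce N') {r : V} (hr0 : d r = 0)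
    (hr : ∀ u : N, u.1 = r → d' (φ u).1 = 0)
    (hN : ∀ u ∈ N, u = r ∨ ∃ p ∈ N, Below H d p u) (n : ℕ) :
    ∀ u : N, d u.1 ≤ n → d' (φ u).1 = d u.1 := by
  have hadj : ∀ u w : N, H.Adj u.1 w.1 → H'.Adj (φ u).1 (φ w).1 := fun u w h =>
    φ.map_adj_iff.2 (SimpleGraph.induce_adj.2 h)
  induction n with
  | zero =>
    intro u hu
    rcases hN u.1 u.2 with e | ⟨p, -, hp⟩
    · rw [hr u e, e, hr0]
    · have := hp.2; omega
  | succ n ih =>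
    intro u hu
    rcases hN u.1 u.2 with e | ⟨p, hpN, hp⟩
    · rw [hr u e, e, hr0]
    have ip := ih ⟨p, hpN⟩ (by have := hp.2; simp only; omega)
    simp only at ip
    rcases hd'.level (hadj ⟨p, hpN⟩ u hp.1) with h | h
    · rcases hN p hpN with e | ⟨q, hqN, hq⟩
      · have := hr ⟨p, hpN⟩ e; omega
      · have iq := ih ⟨q, hqN⟩ (by have := hp.2; have := hq.2; simp only; omega)
        simp only at iq
        have e : (φ ⟨q, hqN⟩).1 = (φ u).1 := hd'.parent (hadj ⟨q, hqN⟩ ⟨p, hpN⟩ hq.1)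
          (hadj ⟨p, hpN⟩ u hp.1).symm (by have := hq.2; omega) h
        have e' : q = u.1 := congrArg Subtype.val (φ.injective (Subtype.ext e))
        have := hp.2; have := hq.2
        rw [e'] at this
        omega
    · have := hp.2; omega

end SoftBit

namespace TannerGraph

open SoftBit

/-! ### Recovery trees as leveled forests. -/

section tree

variable {S C : Type*} (G : TannerGraph S C) (P : Set S) (v : S) (k : ℕ)

/-- The distance of a node from the root. -/
noncomputable def depth (u : S ⊕ C) : ℕ := G.graph.dist (.inl v) u

lemma graph_adj_inl_inr {s : S} {c : C} : G.graph.Adj (.inl s) (.inr c) ↔ G.edge s c := by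
  constructor
  · rintro (⟨s', c', h, h', e⟩ | ⟨s', c', h, h', e⟩)
    · cases h; cases h'; exact e
    · cases h
  · exact fun h => Or.inl ⟨s, c, rfl, rfl, h⟩

lemma even_dist_iff {u : S ⊕ C} (h : G.graph.Reachable (.inl v) u) :
    Even (G.depth v u) ↔ u.isLeft = true := by
  have valid : ∀ {a b : S ⊕ C}, G.graph.Adj a b → a.isLeft ≠ b.isLeft := by
    rintro a b (⟨s, c, rfl, rfl, -⟩ | ⟨s, c, rfl, rfl, -⟩) <;> simp
  obtain ⟨p, hp⟩ := h.exists_walk_length_eq_dist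
  rw [depth, ← hp,
    (SimpleGraph.Coloring.mk (fun u : S ⊕ C => u.isLeft) valid).even_length_iff_congr p]
  change ((Sum.inl v : S ⊕ C).isLeft = true ↔ u.isLeft = true) ↔ _
  simp

variable {G v k}

lemma reachable_of_mem_nbhd {n : ℕ} {u : S ⊕ C} (h : u ∈ G.nbhd n (.inl v)) :
    G.graph.Reachable (.inl v) u := h.elim fun p _ => ⟨p⟩

lemma depth_le_of_mem_nbhd {n : ℕ} {u : S ⊕ C} (h : u ∈ G.nbhd n (.inl v)) :
    G.depth v u ≤ n := h.elim fun p hp => (SimpleGraph.dist_le p).trans hp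

/-- Adjacent depths differ by at most one, and bipartiteness gives them different parities. -/
lemma depth_of_adj {a b : S ⊕ C} (ha : G.graph.Reachable (.inl v) a) (h : G.graph.Adj a b) :
    G.depth v a = G.depth v b + 1 ∨ G.depth v b = G.depth v a + 1 := by
  have hb : G.graph.Reachable (.inl v) b := ha.trans h.reachable
  have hp : ¬(Even (G.depth v a) ↔ Even (G.depth v b)) := by
    rw [G.even_dist_iff v ha, G.even_dist_iff v hb]
    rcases h with ⟨s, c, rfl, rfl, -⟩ | ⟨s, c, rfl, rfl, -⟩ <;> simp
  have hne : G.depth v a ≠ G.depth v b := fun e => hp (by rw [e])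
  have h1 := h.diff_dist_adj (u := Sum.inl v)
  have h2 := h.symm.diff_dist_adj (u := Sum.inl v)
  simp only [depth] at *
  omega

/-- Shortest paths to a through b and through b' stay inside the neighbourhood, since no prefix is
longer than the depth of a. There the graph is acyclic, so the two paths coincide, and with them
their penultimate nodes. -/
lemma TreeLike.parent_unique (hG : G.TreeLike v k) {a b b' : S ⊕ C}
    (ha : a ∈ G.nbhd (2 * k) (.inl v)) (h : G.graph.Adj b a) (h' : G.graph.Adj b' a)
    (e : G.depth v a = G.depth v b + 1) (e' : G.depth v a = G.depth v b' + 1) : b = b' := by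
  classical
  have hra := reachable_of_mem_nbhd ha
  have key : ∀ {b : S ⊕ C} (h : G.graph.Adj b a), G.depth v a = G.depth v b + 1 →
      ∃ (p : G.graph.Walk (.inl v) b), (p.concat h).IsPath ∧
        ∀ u ∈ (p.concat h).support, u ∈ G.nbhd (2 * k) (.inl v) := by
    intro b h e
    obtain ⟨p, hp⟩ := (hra.trans h.symm.reachable).exists_walk_length_eq_dist
    have hl : (p.concat h).length = G.depth v a := by
      rw [SimpleGraph.Walk.length_concat, hp, e]; rfl
    refine ⟨p, SimpleGraph.Walk.isPath_of_length_eq_dist _ hl, fun u hu => ?_⟩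
    refine ⟨(p.concat h).takeUntil u hu, ?_⟩
    have := (p.concat h).length_takeUntil_le_length hu
    have := depth_le_of_mem_nbhd ha
    omega
  obtain ⟨p, hp, hs⟩ := key h e
  obtain ⟨p', hp', hs'⟩ := key h' e'
  have i : ((p.concat h).induce _ hs).IsPath :=
    SimpleGraph.Walk.IsPath.of_map (f := (SimpleGraph.Embedding.induce _).toHom)
      (by rwa [SimpleGraph.Walk.map_induce])
  have i' : ((p'.concat h').induce _ hs').IsPath :=
    SimpleGraph.Walk.IsPath.of_map (f := (SimpleGraph.Embedding.induce _).toHom)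
      (by rwa [SimpleGraph.Walk.map_induce])
  have eq := congrArg Subtype.val ((hG.isAcyclic.subsingleton_path _ _).elim ⟨_, i⟩ ⟨_, i'⟩)
  have eq' := congrArg (SimpleGraph.Walk.map (SimpleGraph.Embedding.induce _).toHom) eq
  rw [SimpleGraph.Walk.map_induce, SimpleGraph.Walk.map_induce] at eq'
  exact (SimpleGraph.Walk.concat_inj eq').1

lemma recoveryTree_adj {a b : S ⊕ C} (h : (G.recoveryTree P v k).graph.Adj a b) :
    G.graph.Adj a b ∧ a ∈ G.nbhd (2 * k) (.inl v) ∧ b ∈ G.nbhd (2 * k) (.inl v) ∧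
      b ∈ G.treeNodes P v k := by
  rcases h with ⟨s, c, rfl, rfl, h, hs⟩ | ⟨s, c, rfl, rfl, h, hs⟩
  · refine ⟨Or.inl ⟨s, c, rfl, rfl, h.2.2.1⟩, h.1, h.2.1, ?_⟩
    exact SimpleGraph.Reachable.trans hs
      (SimpleGraph.Adj.reachable (Or.inl ⟨s, c, rfl, rfl, h⟩))
  · exact ⟨Or.inr ⟨s, c, rfl, rfl, h.2.2.1⟩, h.2.1, h.1, hs⟩

lemma TreeLike.isLeveled (hG : G.TreeLike v k) :
    IsLeveled (G.recoveryTree P v k).graph (G.depth v) where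
  level _ _ h := depth_of_adj (reachable_of_mem_nbhd (recoveryTree_adj P h).2.1)
    (recoveryTree_adj P h).1
  parent _ _ _ h h' e e' := hG.parent_unique (recoveryTree_adj P h).2.2.1
    (recoveryTree_adj P h).1 (recoveryTree_adj P h').1 e e'

lemma depth_root : G.depth v (.inl v) = 0 := SimpleGraph.dist_self

lemma root_mem_treeNodes : Sum.inl v ∈ G.treeNodes P v k := SimpleGraph.Reachable.refl _

lemma recoveryTree_adj_of_pruned {a b : S ⊕ C} (ha : a ∈ G.treeNodes P v k)
    (h : (G.pruned P v k).graph.Adj a b) : (G.recoveryTree P v k).graph.Adj a b := by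
  rcases h with ⟨s, c, rfl, rfl, e⟩ | ⟨s, c, rfl, rfl, e⟩
  · exact Or.inl ⟨s, c, rfl, rfl, e, ha⟩
  · refine Or.inr ⟨s, c, rfl, rfl, e, ?_⟩
    exact SimpleGraph.Reachable.trans ha
      (SimpleGraph.Adj.reachable (Or.inr ⟨s, c, rfl, rfl, e⟩))

/-- Along a walk from the root in the pruned graph every step goes to a child or back to the unique
parent, so each node reached also ends a purely descending path. -/
lemma TreeLike.exists_parent (hG : G.TreeLike v k) {u : S ⊕ C} (hu : u ∈ G.treeNodes P v k) :
    u = .inl v ∨ ∃ p ∈ G.treeNodes P v k,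
      Below (G.recoveryTree P v k).graph (G.depth v) p u := by
  have hd := hG.isLeveled P
  have key : ∀ u, Relation.ReflTransGen (G.pruned P v k).graph.Adj (.inl v) u →
      u ∈ G.treeNodes P v k ∧
        Relation.ReflTransGen (Below (G.recoveryTree P v k).graph (G.depth v)) (.inl v) u := by
    intro u h
    induction h with
    | refl => exact ⟨root_mem_treeNodes P, .refl⟩
    | @tail a b _ hab ih =>
      have hadj := recoveryTree_adj_of_pruned P ih.1 hab
      refine ⟨(recoveryTree_adj P hadj).2.2.2, ?_⟩
      rcases hd.level hadj with e | e
      · rcases ih.2.cases_tail with rfl | ⟨p, hp, hpa⟩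
        · rw [depth_root] at e; omega
        · rwa [hd.parent hadj.symm hpa.1 e hpa.2]
      · exact ih.2.tail ⟨hadj, e⟩
  have h := (key u ((SimpleGraph.reachable_iff_reflTransGen _ _).1 hu)).2
  rcases h.cases_tail with rfl | ⟨p, hp, hpu⟩
  · exact Or.inl rfl
  · refine Or.inr ⟨p, ?_, hpu⟩
    exact (recoveryTree_adj P hpu.1.symm).2.2.2

end tree

/-! ### Sum-product decoding at the root is the upward recursion. -/

section messages

variable {S C : Type*} {T : TannerGraph S C} {d : S ⊕ C → ℕ}

lemma parityMessage_subtype_congr {p q : S → Prop} (h : ∀ w, p w ↔ q w)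
    [Fintype {w // p w}] [DecidableEq {w // p w}] [Fintype {w // q w}] [DecidableEq {w // q w}]
    {m m' : S → ZMod 2 → ℝ≥0∞} (hm : ∀ w, q w → m w = m' w) :
    parityMessage (fun w : {w // p w} => m w.1) = parityMessage fun w : {w // q w} => m' w.1 := by
  obtain rfl : p = q := funext fun w => propext (h w)
  have : (fun w : {w // p w} => m w.1) = fun w : {w // p w} => m' w.1 :=
    funext fun w => hm w.1 w.2
  rw [this]
  congr <;> exact Subsingleton.elim _ _

/-- The only neighbour of c above it is s, so excluding the recipient leaves exactly the children.
-/
lemma _root_.SoftBit.IsLeveled.symbolChild_iff (hd : IsLeveled T.graph d) {s : S} {c : C}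
    (hsc : T.edge s c) (e : d (.inr c) = d (.inl s) + 1) (w : S) :
    T.edge w c ∧ w ≠ s ↔ T.edge w c ∧ d (.inl w) = d (.inr c) + 1 := by
  refine and_congr_right fun hw => ⟨fun hne => ?_, ?_⟩
  · rcases hd.level (T.graph_adj_inl_inr.2 hw) with h | h
    · exact h
    · exact absurd (Sum.inl_injective (hd.parent (T.graph_adj_inl_inr.2 hw)
        (T.graph_adj_inl_inr.2 hsc) h e)) hne
  · rintro h rfl; omega

lemma _root_.SoftBit.IsLeveled.checkChild_iff (hd : IsLeveled T.graph d) {s : S} {c : C}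
    (hsc : T.edge s c) (e : d (.inl s) = d (.inr c) + 1) (c' : C) :
    T.edge s c' ∧ c' ≠ c ↔ T.edge s c' ∧ d (.inr c') = d (.inl s) + 1 := by
  refine and_congr_right fun hw => ⟨fun hne => ?_, ?_⟩
  · rcases hd.level (T.graph_adj_inl_inr.2 hw) with h | h
    · exact absurd (Sum.inr_injective (hd.parent (T.graph_adj_inl_inr.2 hw).symm
        (T.graph_adj_inl_inr.2 hsc).symm h e)) hne
    · exact h
  · rintro h rfl; omega

variable [Fintype S] [Fintype C]

lemma checkMessage_eq_upwardCheck (hd : IsLeveled T.graph d) {ini : S → ZMod 2 → ℝ≥0∞} {t : ℕ}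
    {msg : S → C → ZMod 2 → ℝ≥0∞} {s : S} {c : C} (hsc : T.edge s c)
    (e : d (.inr c) = d (.inl s) + 1)
    (h : ∀ w, T.edge w c → d (.inl w) = d (.inr c) + 1 → msg w c = upward T d ini t w) :
    T.checkMessage msg c s = upwardCheck T d ini t c := by
  classical
  have h1 : T.checkMessage msg c s =
      parityMessage fun w : {w : S // T.edge w c ∧ w ≠ s} => msg w.1 c := by
    funext b
    unfold checkMessage parityMessage
    congr!
  rw [h1]
  exact parityMessage_subtype_congr (m := fun w => msg w c) (hd.symbolChild_iff hsc e)
    fun w hw => h w hw.1 hw.2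

open scoped Classical in
lemma prod_checkMessage_eq (hd : IsLeveled T.graph d) {ini : S → ZMod 2 → ℝ≥0∞} {t : ℕ}
    {msg : S → C → ZMod 2 → ℝ≥0∞} {s : S} {q : C → Prop}
    (hq : ∀ c, q c ↔ T.edge s c ∧ d (.inr c) = d (.inl s) + 1)
    (h : ∀ w c, T.edge w c → d (.inl w) = d (.inr c) + 1 → msg w c = upward T d ini t w)
    (b : ZMod 2) :
    ini s b * ∏ c : C with q c, T.checkMessage msg c s b = upward T d ini (t + 1) s b := by
  rw [upward_succ, Pi.mul_apply, Finset.prod_apply]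
  congr 1
  rw [Finset.prod_subtype (p := fun c => T.edge s c ∧ d (.inr c) = d (.inl s) + 1) _
    (fun c => by simp [hq])]
  refine Finset.prod_congr (by congr!) fun c _ => ?_
  rw [checkMessage_eq_upwardCheck hd c.2.1 c.2.2 fun w => h w c.1]

/-- A message directed towards the root is computed only from messages directed towards the root, so
the downward ones never matter. -/
lemma symbolMessage_eq_upward (hd : IsLeveled T.graph d) (ini : S → ZMod 2 → ℝ≥0∞) (t : ℕ) :
    ∀ s c, T.edge s c → d (.inl s) = d (.inr c) + 1 →
      T.symbolMessage ini t s c = upward T d ini t s := by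
  induction t with
  | zero => intro s c _ _; rfl
  | succ t ih =>
    intro s c hsc e
    funext b
    rw [symbolMessage, ← prod_checkMessage_eq hd (hd.checkChild_iff hsc e) ih b]
    congr!

lemma belief_eq_upward (hd : IsLeveled T.graph d) (ini : S → ZMod 2 → ℝ≥0∞) (t : ℕ) {s : S}
    (hs : d (.inl s) = 0) : T.belief ini t s = upward T d ini t s := by
  cases t with
  | zero => rfl
  | succ t =>
    funext b
    refine prod_checkMessage_eq hd (fun c => ?_) (symbolMessage_eq_upward hd ini t) b
    refine (and_iff_left_of_imp fun h => ?_).symm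
    rcases hd.level (T.graph_adj_inl_inr.2 h) with e | e
    · omega
    · exact e

end messages

/-! ### The isomorphism as a partial embedding, and the error probability. -/

section comparison

variable {S₁ C₁ S₂ C₂ : Type*}
  {G₁ : TannerGraph S₁ C₁} {P₁ : Set S₁} {G₂ : TannerGraph S₂ C₂} {P₂ : Set S₂} {k : ℕ}
  {v₁ : S₁} {v₂ : S₂}

lemma nodeKind_inr {S C : Type*} (P : Set S) (c : C) :
    nodeKind P (Sum.inr c : S ⊕ C) = NodeKind.check := rfl

lemma nodeKind_inl_ne {S C : Type*} (P : Set S) (s : S) :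
    nodeKind P (Sum.inl s : S ⊕ C) ≠ NodeKind.check := by
  simp only [nodeKind]; split_ifs <;> simp

/-- The relations are the graph of the isomorphism, restricted to symbols and to checks; relations
fit because it is defined on tree nodes only. -/
lemma exists_partialEmbedding (h₁ : G₁.TreeLike v₁ k) (h₂ : G₂.TreeLike v₂ k) {x : S₂} {z : C₂}
    (h : IdenticalExcept G₁ P₁ v₁ G₂ P₂ v₂ k x z) :
    ∃ RS RC, PartialEmbedding (G₁.recoveryTree P₁ v₁ k) (G₁.depth v₁) P₁
      (G₂.recoveryTree P₂ v₂ k) (G₂.depth v₂) P₂ RS RC ∧ RS v₁ v₂ := by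
  classical
  obtain ⟨-, -, φ, hroot, hkind⟩ := h
  have hd₂ := h₂.isLeveled P₂
  have hlev : ∀ u, G₂.depth v₂ (φ u).1 = G₁.depth v₁ u.1 := fun u =>
    level_apply_iso hd₂ φ depth_root (fun u hu => by rw [hroot u hu, depth_root])
      (fun u hu => h₁.exists_parent P₁ hu) _ u le_rfl
  have hadj : ∀ u w, (G₁.recoveryTree P₁ v₁ k).graph.Adj u.1 w.1 ↔
      (G₂.recoveryTree P₂ v₂ k).graph.Adj (φ u).1 (φ w).1 := fun u w =>
    SimpleGraph.induce_adj.symm.trans (φ.map_adj_iff.symm.trans SimpleGraph.induce_adj)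
  have hinr : ∀ u c, u.1 = Sum.inr c → ∃ c', (φ u).1 = Sum.inr c' := by
    intro u c hu
    have := hkind u
    rw [hu, nodeKind_inr] at this
    rcases e : (φ u).1 with s | c'
    · rw [e] at this; exact absurd this (nodeKind_inl_ne P₂ s)
    · exact ⟨c', rfl⟩
  have hinl : ∀ u s, u.1 = Sum.inl s → ∃ s', (φ u).1 = Sum.inl s' := by
    intro u s hu
    have := hkind u
    rw [hu] at this
    rcases e : (φ u).1 with s' | c'
    · exact ⟨s', rfl⟩
    · rw [e, nodeKind_inr] at this; exact absurd this.symm (nodeKind_inl_ne P₁ s)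
  have hinl' : ∀ u s', (φ u).1 = Sum.inl s' → ∃ s, u.1 = Sum.inl s := by
    intro u s' hu
    rcases e : u.1 with s | c
    · exact ⟨s, rfl⟩
    · obtain ⟨c', hc'⟩ := hinr u c e
      rw [hu] at hc'; cases hc'
  refine ⟨fun s s' => ∃ h, (φ ⟨Sum.inl s, h⟩).1 = Sum.inl s',
    fun c c' => ∃ h, (φ ⟨Sum.inr c, h⟩).1 = Sum.inr c', ⟨?_, ?_, ?_, ?_, ?_, ?_, ?_⟩, ?_⟩
  · rintro s s' ⟨hs, e⟩
    have := hkind ⟨Sum.inl s, hs⟩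
    rw [e] at this
    unfold nodeKind at this
    by_cases a : s ∈ P₁ <;> by_cases b : s' ∈ P₂ <;> simp_all
  · rintro s t s' ⟨hs, e⟩ ⟨ht, e'⟩
    have := congrArg Subtype.val (φ.injective (Subtype.ext (e.trans e'.symm)))
    exact Sum.inl_injective this
  · rintro s s' t' ⟨hs, e⟩ ⟨hs', e'⟩
    exact Sum.inl_injective (e.symm.trans e')
  · rintro c t c' ⟨hs, e⟩ ⟨ht, e'⟩
    have := congrArg Subtype.val (φ.injective (Subtype.ext (e.trans e'.symm)))
    exact Sum.inr_injective this
  · rintro s s' ⟨hs, e⟩ c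
    have hc := (recoveryTree_adj P₁ c.below.1).2.2.2
    obtain ⟨c', hc'⟩ := hinr ⟨_, hc⟩ c.1 rfl
    have a := (hadj ⟨_, hs⟩ ⟨_, hc⟩).1 c.below.1
    have l := hlev ⟨_, hc⟩
    have l' := hlev ⟨_, hs⟩
    rw [e, hc'] at a
    rw [hc'] at l
    rw [e] at l'
    exact ⟨⟨c', (graph_adj_inl_inr _).1 a, by rw [l, l']; exact c.below.2⟩, hc, hc'⟩
  · rintro c c' ⟨hc, e⟩ w
    have hw := (recoveryTree_adj P₁ w.below.1).2.2.2
    obtain ⟨w', hw'⟩ := hinl ⟨_, hw⟩ w.1 rfl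
    have a := (hadj ⟨_, hc⟩ ⟨_, hw⟩).1 w.below.1
    have l := hlev ⟨_, hw⟩
    have l' := hlev ⟨_, hc⟩
    rw [e, hw'] at a
    rw [hw'] at l
    rw [e] at l'
    exact ⟨⟨w', (graph_adj_inl_inr _).1 a.symm, by rw [l, l']; exact w.below.2⟩, hw, hw'⟩
  · rintro c c' ⟨hc, e⟩ w'
    obtain ⟨hadj', -, hnb, hmem⟩ := recoveryTree_adj P₂ w'.below.1
    -- If a child of the matched check c' descended from z, then so would its unique parent c',
    -- which lies in the range of φ. Hence no child of c' is lost by deleting the descendants of z.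
    have hnd : Sum.inl w'.1 ∉ G₂.descendants v₂ k (Sum.inr z) := by
      intro hdesc
      rcases Relation.ReflTransGen.cases_tail hdesc with h | ⟨p, hp, hpw⟩
      · cases h
      · have : p = Sum.inr c' := h₂.parent_unique hnb hpw.2.1 hadj' hpw.2.2 w'.below.2
        exact (φ ⟨_, hc⟩).2.2 (by rw [e, ← this]; exact hp)
    obtain ⟨u, hu⟩ := φ.surjective ⟨Sum.inl w'.1, hmem, hnd⟩
    have hu' : (φ u).1 = Sum.inl w'.1 := congrArg Subtype.val hu
    obtain ⟨w, hw⟩ := hinl' u w'.1 hu'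
    obtain ⟨u, hun⟩ := u
    obtain rfl : u = Sum.inl w := hw
    have a := (hadj ⟨_, hc⟩ ⟨_, hun⟩).2 (by rw [e, hu']; exact w'.below.1)
    have l := hlev ⟨_, hun⟩
    have l' := hlev ⟨_, hc⟩
    rw [hu'] at l
    rw [e] at l'
    exact ⟨⟨w, (graph_adj_inl_inr _).1 a.symm, by rw [← l, ← l']; exact w'.below.2⟩, hun, hu'⟩
  · exact ⟨root_mem_treeNodes P₁, hroot _ rfl⟩

end comparison

lemma errorProb_eq {S C Y : Type*} [Fintype S] [Fintype C] [MeasurableSpace Y]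
    (W : SymmetricChannel Y) {G : TannerGraph S C} (P : Set S) {k : ℕ} {v : S}
    (h : G.TreeLike v k) : G.errorProb W P k v =
      ENNReal.ofReal ((1 - (∫ x, test 1 0 x
        ∂upwardLaw W P (G.recoveryTree P v k) (G.depth v) k v) / 2) / 2) := by
  have hd := h.isLeveled P
  refine Eq.trans ?_ (error_eq_ofReal_integral (measurable_upward W P _ (G.depth v) k v)
    ((proper_initialMessage_forall_ae W P).mono fun _ h => proper_upward h k v)
    (symmetricLaw_upwardLaw W P hd k v))
  simp only [errorProb, belief_eq_upward hd _ k depth_root]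
  rfl

end TannerGraph

theorem theorem2 {S₁ C₁ S₂ C₂ Y : Type*} [Fintype S₁] [Fintype C₁] [Fintype S₂] [Fintype C₂]
    [MeasurableSpace Y] (W : SymmetricChannel Y)
    (G₁ : TannerGraph S₁ C₁) (P₁ : Set S₁) (G₂ : TannerGraph S₂ C₂) (P₂ : Set S₂)
    (k l : ℕ) (hl : l < k) (v₁ : S₁) (v₂ : S₂)
    (hv₁ : v₁ ∈ G₁.recoverable P₁ k) (hv₂ : v₂ ∈ G₂.recoverable P₂ k)
    (htree₁ : G₁.TreeLike v₁ k) (htree₂ : G₂.TreeLike v₂ k)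
    (x : S₂) (hx : Sum.inl x ∈ G₂.nbhd (2 * l) (Sum.inl v₂))
    (z : C₂) (hz : IsGreatest {m | ∃ w, G₂.edge w z ∧ w ∈ G₂.recoverable P₂ m} (k - l))
    (hT : IdenticalExcept G₁ P₁ v₁ G₂ P₂ v₂ k x z) :
    G₁.errorProb W P₁ k v₁ ≥ G₂.errorProb W P₂ k v₂ := by
  obtain ⟨RS, RC, hR, hv⟩ := TannerGraph.exists_partialEmbedding htree₁ htree₂ hT
  -- With a = 1 and b = 0 the order compares the means of 2|D|, in which the error probability is
  -- decreasing.
  have h := SoftBit.degraded_upwardLaw W hR (htree₁.isLeveled P₁) (htree₂.isLeveled P₂) k v₁ v₂ hv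
    1 0
  rw [TannerGraph.errorProb_eq W P₁ htree₁, TannerGraph.errorProb_eq W P₂ htree₂]
  exact ENNReal.ofReal_le_ofReal (by linarith)
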